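/- All point sets are finite subsets of the plane in general position (no three points on a line). For a set $P$ of $n$ points and an integer $0\le k\le n/2-1$, a $k$-edge of $P$ is a line through two points of $P$ leaving exactly $k$ points of $P$ on one side; $E_k(P)$ is the number of $k$-edges of $P$, $E_{\le k}(P)=\sum_{j=0}^{k}E_j(P)$, and $E_{\le k}(n)$ is the minimum of $E_{\le k}(P)$ over all sets $P$ of $n$ points. A simple allowable sequence on $[n]=\{1,\dots,n\}$ is a doubly infinite sequence $\Pi=(\dots,\pi_{-1},\pi_0,\pi_1,\dots)$ of permutations of $[n]$ such that any two consecutive permutations differ by a transposition of neighboring elements and, for every $j$, $\pi_j$ is the reverse of $\pi_{j+\binom n2}$. For $0\le k\le n/2-1$, let $E_k(\Pi)$ be the number of transpositions in a halfperiod of $\Pi$ (that is, among any $\binom n2$ consecutive transpositions of $\Pi$) that interchange the elements in positions $k+1,k+2$ or in positions $n-k-1,n-k$ (a transposition is counted once if these coincide). Let $E_{\le k}(\Pi)=\sum_{j=0}^{k}E_j(\Pi)$, and let $\widetilde E_{\le k}(n)$ be the minimum of $E_{\le k}(\Pi)$ over all simple allowable sequences $\Pi$ on $[n]$. Let $m=\lceil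 (4n-11)/9\rceil$. For all integers $n$ and $k\ge 0$ such that $m-1\le k\le (n-2)/2$, \[ E_{\le k}(n)\ \ge\ \binom n2-\frac19\sqrt{1-\frac{2k+2}{n}}\,\bigl(5n^2+19n-31\bigr), \] and the same lower bound holds for allowable sequences: \[ \widetilde E_{\le k}(n)\ \ge\ \binom n2-\frac19\sqrt{1-\frac{2k+2}{n}}\,\bigl(5n^2+19n-31\bigr). \] -/

import Mathlib

noncomputable section

namespace KEdges

/-- Twice the signed area of the triangle `p q r`; it is positive exactly when `r` lies strictly to
the left of the line through `p` and `q` directed from `p` to `q`. -/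
def signedArea (p q r : EuclideanSpace ℝ (Fin 2)) : ℝ :=
  (q 0 - p 0) * (r 1 - p 1) - (q 1 - p 1) * (r 0 - p 0)

/-- A finite set of points in the plane is in general position if no three of its points lie on
a line. -/
def InGeneralPosition (P : Finset (EuclideanSpace ℝ (Fin 2))) : Prop :=
  ∀ p ∈ P, ∀ q ∈ P, ∀ r ∈ P, p ≠ q → p ≠ r → q ≠ r → ¬ Collinear ℝ {p, q, r}

open Classical in
/-- The number of points of `P` strictly to the left of the directed line from `p` to `q`. The
number of points strictly to the right of it is `leftCount P q p`. -/
def leftCount (P : Finset (EuclideanSpace ℝ (Fin 2))) (p q : EuclideanSpace ℝ (Fin 2)) : ℕ :=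
  (P.filter fun r => 0 < signedArea p q r).card

open Classical in
/-- The set of `k`-edges of `P`: the lines through two points of `P` that leave exactly `k` points
of `P` on one side. (The pairs `(p, q)` are ordered, so both sides of each line are examined, and
each line counts once.) -/
def kEdges (P : Finset (EuclideanSpace ℝ (Fin 2))) (k : ℕ) :
    Finset (AffineSubspace ℝ (EuclideanSpace ℝ (Fin 2))) :=
  (P.offDiag.filter fun e => leftCount P e.1 e.2 = k).image fun e => line[ℝ, e.1, e.2]

/-- `E_{≤k}(P)`: the number of `(≤ k)`-edges of `P`. -/
def numLE (P : Finset (EuclideanSpace ℝ (Fin 2))) (k : ℕ) : ℕ :=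
  ∑ j ∈ Finset.range (k + 1), (kEdges P j).card

/-- `E_{≤k}(n)`: the minimum of `E_{≤k}(P)` over all sets `P` of `n` points in general position in
the plane. -/
def minLE (n k : ℕ) : ℕ :=
  sInf {e | ∃ P : Finset (EuclideanSpace ℝ (Fin 2)),
    P.card = n ∧ InGeneralPosition P ∧ numLE P k = e}

/-- The permutation `σ` becomes `τ` by interchanging the elements in the neighboring positions `t`
and `t + 1`, where positions are counted from `1` to `n`. A permutation is read as the list of its
values: `σ p` is the element in the position with (zero-based) index `p`. -/
def SwapsAt {n : ℕ} (σ τ : Equiv.Perm (Fin n)) (t : ℕ) : Prop :=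
  ∃ p q : Fin n, (p : ℕ) + 1 = t ∧ (q : ℕ) = t ∧ τ = σ * Equiv.swap p q

/-- A simple allowable sequence on `n` elements: a doubly infinite sequence of permutations in which
consecutive permutations differ by a transposition of neighboring elements, and in which the
`j`-th permutation is the reverse of the `(j + n.choose 2)`-th one, for all `j`. -/
structure AllowableSequence (n : ℕ) where
  perm : ℤ → Equiv.Perm (Fin n)
  adjacent : ∀ i, ∃ t, SwapsAt (perm i) (perm (i + 1)) t
  reverse : ∀ j p, perm j p = perm (j + (n.choose 2 : ℕ)) (Fin.rev p)

namespace AllowableSequence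

variable {n : ℕ}

/-- The `i`-th transposition of `A` is `k`-critical: it interchanges the elements in positions `k`
and `k + 1`, or those in positions `n - k` and `n - k + 1`. -/
def IsCritical (A : AllowableSequence n) (k : ℕ) (i : ℤ) : Prop :=
  ∃ t, SwapsAt (A.perm i) (A.perm (i + 1)) t ∧ (t = k ∨ t + k = n)

open Classical in
/-- The number of `(k + 1)`-critical transpositions in the halfperiod of `A` that starts with the
`a`-th permutation. -/
def numFrom (A : AllowableSequence n) (k : ℕ) (a : ℤ) : ℕ :=
  ((Finset.Ico a (a + (n.choose 2 : ℕ))).filter fun i => A.IsCritical (k + 1) i).card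

/-- `E_k(A)`: the number of `(k + 1)`-critical transpositions in a halfperiod of `A`. By
`numFrom_eq` every halfperiod gives the same number. -/
def num (A : AllowableSequence n) (k : ℕ) : ℕ := A.numFrom k 0

theorem isCritical_add (A : AllowableSequence n) (k : ℕ) (i : ℤ) :
    A.IsCritical k (i + (n.choose 2 : ℕ)) ↔ A.IsCritical k i := by
  have hrev : ∀ j, A.perm (j + (n.choose 2 : ℕ)) = A.perm j * Fin.revPerm := by
    intro j
    ext p
    simp [A.reverse j]
  have hadd : i + (n.choose 2 : ℕ) + 1 = (i + 1) + (n.choose 2 : ℕ) := by ring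
  have hconj : ∀ p q : Fin n, (Fin.revPerm * Equiv.swap p q : Equiv.Perm (Fin n))
      = Equiv.swap (Fin.rev p) (Fin.rev q) * Fin.revPerm := by
    intro p q
    rw [Equiv.mul_swap_eq_swap_mul]
    simp
  unfold IsCritical SwapsAt
  rw [hadd, hrev, hrev]
  constructor
  · rintro ⟨t, ⟨p, q, hp, hq, h⟩, ht⟩
    refine ⟨n - t, ⟨Fin.rev q, Fin.rev p, ?_, ?_, ?_⟩, ?_⟩
    · rw [Fin.val_rev]; omega
    · rw [Fin.val_rev]; omega
    · rw [mul_assoc, hconj, ← mul_assoc] at h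
      rw [Equiv.swap_comm]
      exact mul_right_cancel h
    · omega
  · rintro ⟨t, ⟨p, q, hp, hq, h⟩, ht⟩
    refine ⟨n - t, ⟨Fin.rev q, Fin.rev p, ?_, ?_, ?_⟩, ?_⟩
    · rw [Fin.val_rev]; omega
    · rw [Fin.val_rev]; omega
    · rw [h, mul_assoc, mul_assoc, hconj, Fin.rev_rev, Fin.rev_rev, Equiv.swap_comm]
    · omega

theorem numFrom_succ (A : AllowableSequence n) (k : ℕ) (a : ℤ) :
    A.numFrom k (a + 1) = A.numFrom k a := by
  classical
  unfold numFrom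
  have hcard : ∀ b : ℤ, ((Finset.Ico b (b + (n.choose 2 : ℕ))).filter
      fun i => A.IsCritical (k + 1) i).card
      = ∑ i ∈ Finset.range (n.choose 2), if A.IsCritical (k + 1) (b + i) then 1 else 0 := by
    intro b
    rw [Finset.card_filter, Int.Ico_eq_finset_map, Finset.sum_map]
    simp
  rw [hcard, hcard]
  have h1 := Finset.sum_range_succ (fun i : ℕ => if A.IsCritical (k + 1) (a + i) then 1 else 0)
    (n.choose 2)
  rw [Finset.sum_range_succ'] at h1
  simp only [A.isCritical_add, Nat.cast_add, Nat.cast_one, Nat.cast_zero, add_zero] at h1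
  have h2 := Nat.add_right_cancel h1
  rw [← h2]
  simp only [add_assoc, add_comm (1 : ℤ)]

theorem numFrom_eq (A : AllowableSequence n) (k : ℕ) (a : ℤ) : A.numFrom k a = A.num k := by
  unfold num
  induction a using Int.induction_on with
  | zero => rfl
  | succ i ih => rw [numFrom_succ, ih]
  | pred i ih => rw [← ih, ← numFrom_succ, sub_add_cancel]

/-- `E_{≤k}(A)`: the number of `(≤ k + 1)`-critical transpositions in a halfperiod of `A`. -/
def numLE (A : AllowableSequence n) (k : ℕ) : ℕ :=
  ∑ j ∈ Finset.range (k + 1), A.num j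

end AllowableSequence

/-- The minimum of `E_{≤k}(A)` over all simple allowable sequences `A` on `n` elements. -/
def minLEAllowable (n k : ℕ) : ℕ :=
  sInf {e | ∃ A : AllowableSequence n, A.numLE k = e}

end KEdges

end

noncomputable section

namespace KEdges

/-! Call the gap between positions g and g + 1 gate g, and put κ = k + 1. A halfperiod makes
`n.choose 2` transpositions, one for each pair of elements. Those at the outer κ gates on either
side are all counted by `E_{≤k}`, so the theorem amounts to an upper bound for the number I(κ) of
the other, inner ones.

For κ in the window 4n - 11 ≤ 9κ ≤ 4n - 3 the bound comes from a quadratic lower bound for the outer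
transpositions, `countIco_outer_ge`. It is proved for the subsequence on any set S of elements, by
deleting three elements and lowering κ by two. The deleted p, q, r are each first in S at some time,
so each passes every gate in a halfperiod, and together they take part in at least 6κ - 3 outer
transpositions. They are chosen (`exists_balanced`) so that at any time one half of S holds two of
them and the other half one. Hence the outer κ - 2 gates of the remaining set are still outer in S,
and so is its gate κ - 1 on the side that holds only one. Counting the elements that need not cross
the latter gate (`three_mul_le_card_add_countIco`) yields 3κ - |S| further transpositions.

For larger κ, let B(κ) be the number of transpositions at gates κ and n - κ. Then I(κ) ≤ (n - 2κ -
1) max(B(κ), n - 1) (`countIco_inner_le`): an inner transposition is charged to an element that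
never leaves the center or, failing that, to the later of the last entries of its two elements.
Since B(κ) + I(κ) ≤ I(κ - 1), the case B(κ) ≥ n - 1 gives I(κ) ≤ (1 - 1/(n - 2κ)) I(κ - 1), and √(1
- 2κ/n) falls no faster than these factors (`mul_sqrt_add_two_le`). If B(κ) ≤ n - 1, then I(κ) is
small enough outright.

For point sets, the pairs sorted by slope drive an allowable sequence in which each critical
transposition comes from its own k-edge (`exists_allowableSequence`), so the bound carries over. -/

theorem SwapsAt.unique {n : ℕ} {σ τ : Equiv.Perm (Fin n)} {s t : ℕ} (hs : SwapsAt σ τ s)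
    (ht : SwapsAt σ τ t) : s = t := by
  obtain ⟨p, q, hp, hq, h⟩ := hs
  obtain ⟨p', q', hp', hq', h'⟩ := ht
  have hsw : Equiv.swap p q = Equiv.swap p' q' := mul_left_cancel (h.symm.trans h')
  have hpq : p ≠ q := by
    rintro rfl
    omega
  by_cases h1 : p = p'
  · rw [← hp, ← hp', h1]
  · by_cases h2 : p = q'
    · have := Equiv.swap_apply_left p q
      rw [hsw, h2, Equiv.swap_apply_right] at this
      rw [h2] at hp
      rw [← this] at hq
      omega
    · have := Equiv.swap_apply_left p q
      rw [hsw, Equiv.swap_apply_of_ne_of_ne h1 h2] at this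
      exact absurd this hpq

/-! ### Positions and single transpositions -/

namespace AllowableSequence

variable {n : ℕ} (A : AllowableSequence n)

/-- The length of a halfperiod. -/
def half (_ : AllowableSequence n) : ℤ := (n.choose 2 : ℕ)

/-- The zero-based position of the element `x` in the `t`-th permutation. -/
def pos (t : ℤ) (x : Fin n) : ℕ := (A.perm t).symm x

theorem pos_injective (t : ℤ) : Function.Injective (A.pos t) := fun _ _ h =>
  (A.perm t).symm.injective (Fin.ext h)

theorem exists_swap (t : ℤ) : ∃ x y, A.pos t y = A.pos t x + 1 ∧ A.pos (t + 1) x = A.pos t y ∧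
    A.pos (t + 1) y = A.pos t x ∧ (∀ z, z ≠ x → z ≠ y → A.pos (t + 1) z = A.pos t z) ∧
    SwapsAt (A.perm t) (A.perm (t + 1)) (A.pos t x + 1) := by
  obtain ⟨g, p, q, hp, hq, h⟩ := A.adjacent t
  refine ⟨A.perm t p, A.perm t q, ?_, ?_, ?_, ?_, p, q, ?_, ?_, h⟩
  · simp [pos]; omega
  · have : (A.perm (t + 1)).symm (A.perm t p) = q := by simp [Equiv.symm_apply_eq, h]
    simp [pos, this]
  · have : (A.perm (t + 1)).symm (A.perm t q) = p := by simp [Equiv.symm_apply_eq, h]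
    simp [pos, this]
  · intro z hx hy
    have h1 : (A.perm t).symm z ≠ p := by
      rintro rfl; simp at hx
    have h2 : (A.perm t).symm z ≠ q := by
      rintro rfl; simp at hy
    have h3 : (A.perm (t + 1)).symm z = (A.perm t).symm z := by
      rw [Equiv.symm_apply_eq, h, Equiv.Perm.mul_apply, Equiv.swap_apply_of_ne_of_ne h1 h2]
      simp
    simp [pos, h3]
  · simp [pos]
  · simp [pos]; omega

/-- The element that the `t`-th transposition moves from the smaller to the larger position. -/
def hi (t : ℤ) : Fin n := (A.exists_swap t).choose

/-- The element that the `t`-th transposition moves from the larger to the smaller position. -/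
def lo (t : ℤ) : Fin n := (A.exists_swap t).choose_spec.choose

theorem pos_lo (t : ℤ) : A.pos t (A.lo t) = A.pos t (A.hi t) + 1 :=
  (A.exists_swap t).choose_spec.choose_spec.1

theorem pos_succ_hi (t : ℤ) : A.pos (t + 1) (A.hi t) = A.pos t (A.lo t) :=
  (A.exists_swap t).choose_spec.choose_spec.2.1

theorem pos_succ_lo (t : ℤ) : A.pos (t + 1) (A.lo t) = A.pos t (A.hi t) :=
  (A.exists_swap t).choose_spec.choose_spec.2.2.1

theorem pos_succ_of_ne {t : ℤ} {x : Fin n} (h : x ≠ A.hi t) (h' : x ≠ A.lo t) :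
    A.pos (t + 1) x = A.pos t x :=
  (A.exists_swap t).choose_spec.choose_spec.2.2.2.1 x h h'

theorem swapsAt_pos (t : ℤ) : SwapsAt (A.perm t) (A.perm (t + 1)) (A.pos t (A.hi t) + 1) :=
  (A.exists_swap t).choose_spec.choose_spec.2.2.2.2

theorem isCritical_iff (k : ℕ) (t : ℤ) :
    A.IsCritical k t ↔ A.pos t (A.hi t) + 1 = k ∨ A.pos t (A.hi t) + 1 + k = n := by
  constructor
  · rintro ⟨g, hg, h⟩
    rwa [(A.swapsAt_pos t).unique hg]
  · exact fun h => ⟨_, A.swapsAt_pos t, h⟩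

theorem hi_ne_lo (t : ℤ) : A.hi t ≠ A.lo t := by
  intro h
  have := A.pos_lo t
  rw [h] at this
  omega

theorem pos_add_half (t : ℤ) (x : Fin n) : A.pos (t + A.half) x + A.pos t x + 1 = n := by
  have h := A.reverse t ((A.perm t).symm x)
  rw [Equiv.apply_symm_apply] at h
  have h2 : (A.perm (t + A.half)).symm x = Fin.rev ((A.perm t).symm x) := by
    rw [Equiv.symm_apply_eq]; exact h
  have := ((A.perm t).symm x).isLt
  simp only [pos, h2, Fin.val_rev]
  omega

theorem hi_iff {t : ℤ} {x : Fin n} : x = A.hi t ↔ A.pos t x < A.pos (t + 1) x := by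
  constructor
  · rintro rfl
    rw [A.pos_succ_hi, A.pos_lo]; omega
  · intro h
    by_contra hx
    by_cases hy : x = A.lo t
    · subst hy
      rw [A.pos_succ_lo, A.pos_lo] at h
      omega
    · rw [A.pos_succ_of_ne hx hy] at h
      omega

theorem lo_iff {t : ℤ} {x : Fin n} : x = A.lo t ↔ A.pos (t + 1) x < A.pos t x := by
  constructor
  · rintro rfl
    rw [A.pos_succ_lo, A.pos_lo]; omega
  · intro h
    by_contra hx
    by_cases hy : x = A.hi t
    · subst hy
      rw [A.pos_succ_hi, A.pos_lo] at h
      omega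
    · rw [A.pos_succ_of_ne hy hx] at h
      omega

theorem hi_add_half (t : ℤ) : A.hi (t + A.half) = A.lo t := by
  rw [eq_comm, hi_iff]
  have h1 := A.pos_add_half t (A.lo t)
  have h2 := A.pos_add_half (t + 1) (A.lo t)
  rw [show t + 1 + A.half = t + A.half + 1 by ring] at h2
  have h3 := A.pos_lo t
  have h4 := A.pos_succ_lo t
  omega

theorem lo_add_half (t : ℤ) : A.lo (t + A.half) = A.hi t := by
  rw [eq_comm, lo_iff]
  have h1 := A.pos_add_half t (A.hi t)
  have h2 := A.pos_add_half (t + 1) (A.hi t)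
  rw [show t + 1 + A.half = t + A.half + 1 by ring] at h2
  have h3 := A.pos_lo t
  have h4 := A.pos_succ_hi t
  omega

/-- The unordered pair of elements interchanged by the `t`-th transposition. -/
def swapped (t : ℤ) : Sym2 (Fin n) := s(A.hi t, A.lo t)

theorem swapped_add_half (t : ℤ) : A.swapped (t + A.half) = A.swapped t := by
  rw [swapped, hi_add_half, lo_add_half, swapped, Sym2.eq_swap]

theorem pos_lt_succ_iff {t : ℤ} {x y : Fin n} (h : s(x, y) ≠ A.swapped t) :
    A.pos (t + 1) x < A.pos (t + 1) y ↔ A.pos t x < A.pos t y := by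
  have e1 := A.pos_lo t
  have e2 := A.pos_succ_hi t
  have e3 := A.pos_succ_lo t
  have key : ∀ z, z ≠ A.hi t → z ≠ A.lo t → A.pos (t + 1) z = A.pos t z ∧
      A.pos t z ≠ A.pos t (A.hi t) ∧ A.pos t z ≠ A.pos t (A.lo t) := fun z h1 h2 =>
    ⟨A.pos_succ_of_ne h1 h2, fun h => h1 (A.pos_injective t h), fun h => h2 (A.pos_injective t h)⟩
  rw [swapped] at h
  by_cases hx : x = A.hi t
  · subst hx
    by_cases hy : y = A.hi t
    · subst hy; omega
    · have hy' : y ≠ A.lo t := by rintro rfl; exact h rfl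
      have := key y hy hy'
      omega
  · by_cases hx' : x = A.lo t
    · subst hx'
      by_cases hy : y = A.lo t
      · subst hy; omega
      · have hy' : y ≠ A.hi t := by rintro rfl; exact h Sym2.eq_swap
        have := key y hy' hy
        omega
    · have := key x hx hx'
      by_cases hy : y = A.hi t
      · subst hy; omega
      · by_cases hy' : y = A.lo t
        · subst hy'; omega
        · have := key y hy hy'
          omega

theorem pos_lt_of_forall_ne {s t : ℤ} (hst : s ≤ t) {x y : Fin n}
    (h : ∀ i, s ≤ i → i < t → A.swapped i ≠ s(x, y)) :
    A.pos t x < A.pos t y ↔ A.pos s x < A.pos s y := by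
  induction t, hst using Int.leInduction with
  | base => rfl
  | succ t hst ih =>
    rw [A.pos_lt_succ_iff (h t hst (by omega)).symm, ih fun i h1 h2 => h i h1 (by omega)]

theorem half_nonneg : 0 ≤ A.half := Int.natCast_nonneg _

/-- A halfperiod reverses the order of x and y, and only a transposition of the two can change it.
-/
theorem exists_swapped (s : ℤ) {x y : Fin n} (hxy : x ≠ y) :
    ∃ t, s ≤ t ∧ t < s + A.half ∧ A.swapped t = s(x, y) := by
  by_contra! hcon
  have h := A.pos_lt_of_forall_ne (by have := A.half_nonneg; omega : s ≤ s + A.half) hcon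
  have h1 := A.pos_add_half s x
  have h2 := A.pos_add_half s y
  have h3 : A.pos s x ≠ A.pos s y := fun h => hxy (A.pos_injective s h)
  omega

/-- Every pair occurs in the halfperiod, which has exactly as many steps as there are pairs, so none
occurs twice. -/
theorem swapped_inj {s t t' : ℤ} (ht : s ≤ t) (ht2 : t < s + A.half) (ht' : s ≤ t')
    (ht2' : t' < s + A.half) (h : A.swapped t = A.swapped t') : t = t' := by
  have key := Finset.inj_on_of_surj_on_of_card_le (s := Finset.Ico s (s + A.half))
    (t := Finset.univ.filter fun e : Sym2 (Fin n) => ¬ e.IsDiag) (fun i _ => A.swapped i)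
    (by
      intro i _
      simpa [swapped] using A.hi_ne_lo i)
    (by
      intro e he
      induction e with | _ x y
      obtain ⟨i, h1, h2, h3⟩ := A.exists_swapped s (x := x) (y := y) (by simpa using he)
      exact ⟨i, by simp [h1, h2], h3⟩)
    (by
      have := Sym2.card_subtype_not_diag (α := Fin n)
      rw [Fintype.card_subtype, Fintype.card_fin] at this
      rw [this]
      simp [half])
  exact key (by simp [ht, ht2]) (by simp [ht', ht2']) h

theorem pos_hi_lt (t : ℤ) : A.pos t (A.hi t) < A.pos t (A.lo t) := by
  rw [A.pos_lo]; omega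

/-- Within a halfperiod, a pair that is swapped at time `t` has not been swapped before. -/
theorem hi_before {s t : ℤ} (hst : s ≤ t) (ht : t < s + A.half) :
    A.pos s (A.hi t) < A.pos s (A.lo t) := by
  rw [← A.pos_lt_of_forall_ne hst]
  · exact A.pos_hi_lt t
  · intro i h1 h2 h3
    have := A.swapped_inj h1 (by omega) hst ht h3
    omega

/-! ### The subsequence on a subset, seen through ranks -/

section Rank

variable (S : Finset (Fin n))

/-- The number of elements of `S` that precede `x` in the `t`-th permutation. -/
def rank (t : ℤ) (x : Fin n) : ℕ := (S.filter fun z => A.pos t z < A.pos t x).card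

/-- The `t`-th transposition interchanges two elements of `S`. -/
def Within (t : ℤ) : Prop := A.hi t ∈ S ∧ A.lo t ∈ S

/-- If the `t`-th transposition interchanges two elements of `S`, then it moves them across this
gate of the subsequence on `S`. -/
def gate (t : ℤ) : ℕ := A.rank S t (A.hi t) + 1

variable {S}

theorem rank_strictMono {t : ℤ} {x y : Fin n} (hx : x ∈ S) (h : A.pos t x < A.pos t y) :
    A.rank S t x < A.rank S t y := by
  apply Finset.card_lt_card
  refine ⟨fun z hz => ?_, fun hsub => ?_⟩
  · rw [Finset.mem_filter] at hz ⊢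
    exact ⟨hz.1, hz.2.trans h⟩
  · have := hsub (Finset.mem_filter.2 ⟨hx, h⟩)
    simp at this

theorem rank_lt_iff {t : ℤ} {x y : Fin n} (hx : x ∈ S) (hy : y ∈ S) :
    A.rank S t x < A.rank S t y ↔ A.pos t x < A.pos t y := by
  refine ⟨fun h => ?_, A.rank_strictMono hx⟩
  by_contra hle
  rcases (not_lt.1 hle).lt_or_eq with h1 | h1
  · exact absurd (A.rank_strictMono hy h1) (by omega)
  · rw [A.pos_injective t h1] at h
    omega

theorem rank_injOn (t : ℤ) : Set.InjOn (A.rank S t) S := by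
  intro x hx y hy h
  by_contra hne
  rcases Nat.lt_or_gt_of_ne (fun h => hne (A.pos_injective t h)) with h1 | h1
  · exact absurd (A.rank_strictMono hx h1) (by omega)
  · exact absurd (A.rank_strictMono hy h1) (by omega)

theorem rank_lt_card {t : ℤ} {x : Fin n} (hx : x ∈ S) : A.rank S t x < S.card := by
  apply Finset.card_lt_card
  exact ⟨Finset.filter_subset _ _, fun h => by simpa using h hx⟩

theorem rank_add_half (t : ℤ) {x : Fin n} (hx : x ∈ S) :
    A.rank S (t + A.half) x + A.rank S t x + 1 = S.card := by
  have h1 : (S.filter fun z => A.pos (t + A.half) z < A.pos (t + A.half) x)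
      = S.filter fun z => A.pos t x < A.pos t z := by
    apply Finset.filter_congr
    intro z _
    have := A.pos_add_half t x
    have := A.pos_add_half t z
    omega
  have h2 : S = (S.filter fun z => A.pos t x < A.pos t z) ∪
      ((S.filter fun z => A.pos t z < A.pos t x) ∪ {x}) := by
    ext z
    simp only [Finset.mem_union, Finset.mem_filter, Finset.mem_singleton]
    constructor
    · intro hz
      rcases lt_trichotomy (A.pos t x) (A.pos t z) with h | h | h
      · exact Or.inl ⟨hz, h⟩
      · exact Or.inr (Or.inr (A.pos_injective t h).symm)
      · exact Or.inr (Or.inl ⟨hz, h⟩)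
    · rintro (h | h | rfl)
      exacts [h.1, h.1, hx]
  rw [rank, rank, h1]
  conv_rhs => rw [h2]
  rw [Finset.card_union_of_disjoint, Finset.card_union_of_disjoint, Finset.card_singleton]
  · ring
  · simp
  · rw [Finset.disjoint_left]
    intro z hz hz'
    simp only [Finset.mem_union, Finset.mem_filter, Finset.mem_singleton] at hz hz'
    rcases hz' with h | rfl
    · omega
    · omega

theorem rank_add_two_half (t : ℤ) {x : Fin n} (hx : x ∈ S) :
    A.rank S (t + 2 * A.half) x = A.rank S t x := by
  have h1 := A.rank_add_half t hx
  have h2 := A.rank_add_half (t + A.half) hx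
  rw [show t + A.half + A.half = t + 2 * A.half by ring] at h2
  omega

theorem rank_lo {t : ℤ} (h : A.Within S t) : A.rank S t (A.lo t) = A.rank S t (A.hi t) + 1 := by
  have h2 : (S.filter fun z => A.pos t z < A.pos t (A.lo t))
      = insert (A.hi t) (S.filter fun z => A.pos t z < A.pos t (A.hi t)) := by
    ext z
    simp only [Finset.mem_filter, Finset.mem_insert]
    have e := A.pos_lo t
    constructor
    · rintro ⟨hz, h1⟩
      by_cases h3 : A.pos t z = A.pos t (A.hi t)
      · exact Or.inl (A.pos_injective t h3)
      · exact Or.inr ⟨hz, by omega⟩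
    · rintro (rfl | h1)
      · exact ⟨h.1, by omega⟩
      · exact ⟨h1.1, by omega⟩
  rw [rank, h2, Finset.card_insert_of_notMem (by simp), rank]

theorem rank_succ_of_ne {t : ℤ} {x : Fin n} (h : A.Within S t → x ≠ A.hi t ∧ x ≠ A.lo t)
    (hx : x ∈ S) : A.rank S (t + 1) x = A.rank S t x := by
  rw [rank, rank]
  congr 1
  apply Finset.filter_congr
  intro z hz
  apply A.pos_lt_succ_iff
  intro hs
  rw [swapped, Sym2.eq_iff] at hs
  rcases hs with ⟨rfl, rfl⟩ | ⟨rfl, rfl⟩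
  · exact (h ⟨hz, hx⟩).2 rfl
  · exact (h ⟨hx, hz⟩).1 rfl

theorem rank_succ_hi {t : ℤ} (h : A.Within S t) :
    A.rank S (t + 1) (A.hi t) = A.rank S t (A.hi t) + 1 := by
  rw [← A.rank_lo h, rank, rank]
  apply Finset.card_bij' (fun z _ => Equiv.swap (A.hi t) (A.lo t) z)
    (fun z _ => Equiv.swap (A.hi t) (A.lo t) z)
  · intro z hz
    rw [Finset.mem_filter] at hz ⊢
    rw [A.pos_succ_hi] at hz
    by_cases h1 : z = A.hi t
    · subst h1
      rw [A.pos_succ_hi] at hz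
      omega
    by_cases h2 : z = A.lo t
    · subst h2
      rw [Equiv.swap_apply_right]
      exact ⟨h.1, A.pos_hi_lt t⟩
    · rw [Equiv.swap_apply_of_ne_of_ne h1 h2]
      rw [A.pos_succ_of_ne h1 h2] at hz
      exact hz
  · intro z hz
    rw [Finset.mem_filter] at hz ⊢
    rw [A.pos_succ_hi]
    by_cases h1 : z = A.lo t
    · subst h1
      omega
    by_cases h2 : z = A.hi t
    · subst h2
      rw [Equiv.swap_apply_left, A.pos_succ_lo]
      exact ⟨h.2, A.pos_hi_lt t⟩
    · rw [Equiv.swap_apply_of_ne_of_ne h2 h1]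
      rw [A.pos_succ_of_ne h2 h1]
      exact hz
  · simp
  · simp

theorem rank_succ_lo (t : ℤ) :
    A.rank S (t + 1) (A.lo t) = A.rank S t (A.hi t) := by
  rw [rank, rank]
  congr 1
  ext z
  simp only [Finset.mem_filter]
  refine and_congr_right fun hz => ?_
  rw [A.pos_succ_lo]
  have := A.pos_lo t
  have := A.pos_succ_hi t
  have := A.pos_succ_lo t
  by_cases h1 : z = A.lo t
  · subst h1
    omega
  by_cases h2 : z = A.hi t
  · subst h2
    omega
  · rw [A.pos_succ_of_ne h2 h1]

theorem within_add_half (t : ℤ) : A.Within S (t + A.half) ↔ A.Within S t := by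
  rw [Within, Within, hi_add_half, lo_add_half, and_comm]

theorem gate_pos (t : ℤ) : 0 < A.gate S t := Nat.succ_pos _

theorem gate_lt_card {t : ℤ} (h : A.Within S t) : A.gate S t < S.card := by
  rw [gate, ← A.rank_lo h]
  exact A.rank_lt_card h.2

theorem gate_add_half {t : ℤ} (h : A.Within S t) :
    A.gate S (t + A.half) + A.gate S t = S.card := by
  have h1 := A.rank_add_half t h.2
  have h2 := A.rank_lo h
  rw [gate, gate, hi_add_half]
  omega

/-- An element that is first among `S` at time `s` only moves down during the halfperiod that
starts at time `s`. -/
theorem ne_lo_of_rank_eq_zero {s t : ℤ} {x : Fin n} (h0 : A.rank S s x = 0)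
    (hst : s ≤ t) (ht : t < s + A.half) (hw : A.Within S t) : x ≠ A.lo t := by
  rintro rfl
  have := A.rank_strictMono hw.1 (A.hi_before hst ht)
  omega

/-- From the front of S, x can only be overtaken by elements that it has overtaken before, and a
pair meets once per halfperiod. -/
theorem rank_mono {s t t' : ℤ} {x : Fin n} (hx : x ∈ S) (h0 : A.rank S s x = 0)
    (hst : s ≤ t) (htt' : t ≤ t') (ht : t' ≤ s + A.half) : A.rank S t x ≤ A.rank S t' x := by
  induction t', htt' using Int.leInduction with
  | base => rfl
  | succ i hi ih =>
    refine (ih (by omega)).trans ?_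
    by_cases h : A.Within S i ∧ x = A.hi i
    · rw [h.2, A.rank_succ_hi h.1]
      omega
    · rw [A.rank_succ_of_ne (fun hw => ⟨fun h' => h ⟨hw, h'⟩,
        A.ne_lo_of_rank_eq_zero h0 (by omega) (by omega) hw⟩) hx]

end Rank

end AllowableSequence

/-! ### Counting times in an interval -/

open Classical in
/-- The number of integers `t` with `a ≤ t < b` that satisfy `Q`. -/
def countIco (Q : ℤ → Prop) (a b : ℤ) : ℕ := ((Finset.Ico a b).filter Q).card

theorem countIco_mono {Q R : ℤ → Prop} {a b : ℤ} (h : ∀ t, a ≤ t → t < b → Q t → R t) :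
    countIco Q a b ≤ countIco R a b := by
  classical
  apply Finset.card_le_card
  intro t ht
  simp only [Finset.mem_filter, Finset.mem_Ico] at ht ⊢
  exact ⟨ht.1, h t ht.1.1 ht.1.2 ht.2⟩

theorem countIco_append (Q : ℤ → Prop) {a b c : ℤ} (hab : a ≤ b) (hbc : b ≤ c) :
    countIco Q a b + countIco Q b c = countIco Q a c := by
  classical
  rw [countIco, countIco, countIco, ← Finset.card_union_of_disjoint, ← Finset.filter_union,
    Finset.Ico_union_Ico_eq_Ico hab hbc]
  apply Finset.disjoint_filter_filter
  exact Finset.Ico_disjoint_Ico_consecutive a b c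

theorem countIco_add_le {Q R U : ℤ → Prop} {a b : ℤ} (hQ : ∀ t, a ≤ t → t < b → Q t → U t)
    (hR : ∀ t, a ≤ t → t < b → R t → U t) (hQR : ∀ t, a ≤ t → t < b → Q t → ¬ R t) :
    countIco Q a b + countIco R a b ≤ countIco U a b := by
  classical
  rw [countIco, countIco, ← Finset.card_union_of_disjoint]
  · apply Finset.card_le_card
    intro t ht
    simp only [Finset.mem_union, Finset.mem_filter, Finset.mem_Ico] at ht ⊢
    rcases ht with ht | ht
    · exact ⟨ht.1, hQ t ht.1.1 ht.1.2 ht.2⟩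
    · exact ⟨ht.1, hR t ht.1.1 ht.1.2 ht.2⟩
  · rw [Finset.disjoint_left]
    intro t ht ht'
    simp only [Finset.mem_filter, Finset.mem_Ico] at ht ht'
    exact hQR t ht.1.1 ht.1.2 ht.2 ht'.2

theorem countIco_le_add {Q R U : ℤ → Prop} {a b : ℤ}
    (h : ∀ t, a ≤ t → t < b → U t → Q t ∨ R t) :
    countIco U a b ≤ countIco Q a b + countIco R a b := by
  classical
  refine le_trans (Finset.card_le_card ?_) (Finset.card_union_le _ _)
  intro t ht
  simp only [Finset.mem_union, Finset.mem_filter, Finset.mem_Ico] at ht ⊢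
  exact (h t ht.1.1 ht.1.2 ht.2).imp (fun h => ⟨ht.1, h⟩) fun h => ⟨ht.1, h⟩

theorem countIco_self (Q : ℤ → Prop) (a : ℤ) : countIco Q a a = 0 := by simp [countIco]

theorem countIco_succ (Q : ℤ → Prop) {a b : ℤ} (hab : a ≤ b) [Decidable (Q b)] :
    countIco Q a (b + 1) = countIco Q a b + if Q b then 1 else 0 := by
  rw [← countIco_append Q hab (by omega : b ≤ b + 1)]
  congr 1
  have : Finset.Ico b (b + 1) = {b} := by ext; simp; omega
  rw [countIco, this, Finset.filter_singleton]
  split_ifs <;> simp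

theorem countIco_shift {Q : ℤ → Prop} {N : ℤ} (hN : 0 ≤ N) (hQ : ∀ t, Q (t + N) ↔ Q t) (a b : ℤ) :
    countIco Q a (a + N) = countIco Q b (b + N) := by
  classical
  have step : ∀ c : ℤ, countIco Q (c + 1) (c + 1 + N) = countIco Q c (c + N) := by
    intro c
    have h1 := countIco_succ Q (by omega : c ≤ c + N)
    have h2 := countIco_append Q (by omega : c ≤ c + 1) (by omega : c + 1 ≤ c + N + 1)
    have h3 := countIco_succ Q (le_refl c)
    rw [countIco_self] at h3
    simp only [hQ] at h1
    rw [show c + 1 + N = c + N + 1 by ring]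
    omega
  have key : ∀ c : ℤ, countIco Q c (c + N) = countIco Q 0 (0 + N) := by
    intro c
    induction c using Int.induction_on with
    | zero => rfl
    | succ i ih => rw [step, ih]
    | pred i ih => rw [← ih, ← step, sub_add_cancel]
  rw [key a, key b]

/-! ### Extreme elements and the choice of three to delete -/

namespace AllowableSequence

variable {n : ℕ} (A : AllowableSequence n) {S : Finset (Fin n)}

/-- The `t`-th transposition crosses one of the outer `κ` gates, on either side, of the
subsequence on `S`. -/
def Outer (S : Finset (Fin n)) (κ : ℕ) (t : ℤ) : Prop :=
  A.Within S t ∧ (A.gate S t ≤ κ ∨ S.card ≤ A.gate S t + κ)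

theorem outer_add_half (κ : ℕ) (t : ℤ) : A.Outer S κ (t + A.half) ↔ A.Outer S κ t := by
  rw [Outer, Outer, within_add_half]
  refine and_congr_right fun h => ?_
  have := A.gate_add_half h
  omega

theorem half_pos {x y : Fin n} (h : x ≠ y) : 0 < A.half := by
  obtain ⟨t, h1, h2, -⟩ := A.exists_swapped 0 h
  omega

theorem exists_rank_eq_zero (t : ℤ) (hS : S.Nonempty) : ∃ x ∈ S, A.rank S t x = 0 := by
  obtain ⟨x, hx, h⟩ := S.exists_min_image (A.pos t) hS
  refine ⟨x, hx, ?_⟩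
  rw [rank, Finset.card_eq_zero, Finset.filter_eq_empty_iff]
  exact fun z hz => not_lt.2 (h z hz)

/-- A discrete intermediate value argument: the rank of x starts at 0 and rises by at most one at a
time. -/
theorem exists_gate_of_lt_rank {s t : ℤ} {x : Fin n} {j : ℕ} (hx : x ∈ S)
    (h0 : A.rank S s x = 0) (hst : s ≤ t) (ht : t ≤ s + A.half) (hj : j < A.rank S t x) :
    ∃ i, s ≤ i ∧ i < t ∧ A.Within S i ∧ x = A.hi i ∧ A.rank S i x = j := by
  induction t, hst using Int.leInduction with
  | base => omega
  | succ t hst ih =>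
    by_cases hlt : j < A.rank S t x
    · obtain ⟨i, h1, h2, h3⟩ := ih (by omega) hlt
      exact ⟨i, h1, by omega, h3⟩
    · by_cases h : A.Within S t ∧ x = A.hi t
      · refine ⟨t, hst, by omega, h.1, h.2, ?_⟩
        rw [h.2, A.rank_succ_hi h.1, ← h.2] at hj
        omega
      · rw [A.rank_succ_of_ne (fun hw => ⟨fun h' => h ⟨hw, h'⟩,
          A.ne_lo_of_rank_eq_zero h0 (by omega) (by omega) hw⟩) hx] at hj
        omega

theorem exists_gate {s : ℤ} {x : Fin n} {j : ℕ} (hx : x ∈ S) (h0 : A.rank S s x = 0)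
    (hj : j + 1 < S.card) :
    ∃ i, s ≤ i ∧ i < s + A.half ∧ A.Within S i ∧ x = A.hi i ∧ A.rank S i x = j := by
  have := A.rank_add_half s hx
  exact A.exists_gate_of_lt_rank hx h0 (by have := A.half_nonneg; omega) le_rfl (by omega)

/-- The element `x` is extreme in `S`: it is the first element of `S` in some permutation. -/
def Extreme (S : Finset (Fin n)) (x : Fin n) : Prop := x ∈ S ∧ ∃ s, A.rank S s x = 0

/-- Over the halfperiod in which x runs from first to last it passes every gate, in particular the
2κ outer ones, which are distinct because 2κ < |S|. Periodicity transfers the count to any window.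
-/
theorem two_mul_le_countIco_outer {x : Fin n} (hx : A.Extreme S x) {κ : ℕ} (hκ : 2 * κ < S.card)
    (w : ℤ) : 2 * κ ≤ countIco (fun t => A.Outer S κ t ∧ x ∈ A.swapped t) w (w + A.half) := by
  classical
  obtain ⟨hx, s, h0⟩ := hx
  rw [countIco_shift A.half_nonneg (fun t => by rw [outer_add_half, swapped_add_half]) w s]
  have hcard : (Finset.Icc 1 κ ∪ Finset.Ico (S.card - κ) S.card).card = 2 * κ := by
    rw [Finset.card_union_of_disjoint, Nat.card_Icc, Nat.card_Ico]
    · omega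
    · rw [Finset.disjoint_left]
      intro j hj hj'
      simp only [Finset.mem_Icc, Finset.mem_Ico] at hj hj'
      omega
  rw [← hcard]
  apply Finset.card_le_card_of_surjOn (A.gate S)
  intro j hj
  simp only [Finset.coe_union, Finset.coe_Icc, Finset.coe_Ico, Set.mem_union, Set.mem_Icc,
    Set.mem_Ico] at hj
  obtain ⟨i, h1, h2, h3, h4, h5⟩ := A.exists_gate (j := j - 1) hx h0 (by omega)
  have hg : A.gate S i = j := by
    rw [gate, ← h4, h5]; omega
  refine ⟨i, ?_, hg⟩
  simp only [Finset.coe_filter, Finset.mem_Ico, Set.mem_ofPred_eq]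
  refine ⟨⟨h1, h2⟩, ⟨h3, by omega⟩, ?_⟩
  rw [h4, swapped]
  exact Sym2.mem_mk_left _ _

/-- Among the permutations, `x` passes from the first half of `S` to the second half at time `c`,
and from the second half to the first one at time `c - A.half`. -/
structure Crosses (S : Finset (Fin n)) (x : Fin n) (c : ℤ) : Prop where
  above : ∀ t, c - A.half < t → t ≤ c → 2 * A.rank S t x + 1 ≤ S.card
  below : ∀ t, c < t → t ≤ c + A.half → S.card ≤ 2 * A.rank S t x + 1
  strict : S.card < 2 * A.rank S (c + 1) x + 1

/-- Take for c the last time of the halfperiod at which x is still in the first half; ranks are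
monotone there and reflected in the neighboring halfperiods. For odd |S| the middle rank belongs to
both halves, which is why `strict` is recorded separately. -/
theorem exists_crosses {s : ℤ} {x : Fin n} (hx : x ∈ S) (h0 : A.rank S s x = 0)
    (hS : 2 ≤ S.card) : ∃ c, s ≤ c ∧ c < s + A.half ∧ A.Crosses S x c := by
  classical
  have hhalf : 0 < A.half := by
    obtain ⟨y, hy, z, hz, h⟩ := Finset.one_lt_card.1 (by omega : 1 < S.card)
    exact A.half_pos h
  obtain ⟨c, hc, hmax⟩ := ((Finset.Ico s (s + A.half)).filter
    fun t => 2 * A.rank S t x + 1 ≤ S.card).exists_max_image id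
    ⟨s, by simp only [Finset.mem_filter, Finset.mem_Ico]; omega⟩
  simp only [Finset.mem_filter, Finset.mem_Ico, id] at hc hmax
  have hlast : ∀ t, c < t → t ≤ s + A.half → S.card < 2 * A.rank S t x + 1 := by
    intro t h1 h2
    by_contra hle
    rcases h2.lt_or_eq with h3 | rfl
    · have := hmax t ⟨by omega, by omega⟩
      omega
    · have := A.rank_add_half s hx
      omega
  have habove : ∀ t, c - A.half < t → t ≤ c → 2 * A.rank S t x + 1 ≤ S.card := by
    intro t h1 h2
    rcases le_or_gt s t with h3 | h3
    · have := A.rank_mono hx h0 h3 h2 (by omega)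
      omega
    · have := hlast (t + A.half) (by omega) (by omega)
      have := A.rank_add_half t hx
      omega
  refine ⟨c, hc.1.1, hc.1.2, habove, ?_, hlast _ (by omega) (by omega)⟩
  intro t h1 h2
  have h3 := habove (t - A.half) (by omega) (by omega)
  have h4 := A.rank_add_half (t - A.half) hx
  rw [sub_add_cancel] at h4
  omega

theorem Crosses.lt_of_lt {A : AllowableSequence n} {x : Fin n} {c c' : ℤ} (h : A.Crosses S x c)
    (h' : A.Crosses S x c') (hlt : c < c') : c + A.half < c' := by
  by_contra hle
  have := h'.above (c + 1) (by omega) (by omega)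
  have := h.strict
  omega

/-- Three distinct extreme elements suffice. One is x, first at time 0; at a time when x has rank 1,
the elements that are then first and last are two more, since the reversal makes the last one first.
-/
theorem exists_extreme_ne_ne (hS : 3 ≤ S.card) (p q : Fin n) :
    ∃ r, r ≠ p ∧ r ≠ q ∧ A.Extreme S r := by
  have hne : S.Nonempty := Finset.card_pos.1 (by omega)
  obtain ⟨x, hx, hx0⟩ := A.exists_rank_eq_zero 0 hne
  obtain ⟨t, -, -, -, -, hxt⟩ := A.exists_gate (j := 1) hx hx0 (by omega)
  obtain ⟨y, hy, hy0⟩ := A.exists_rank_eq_zero t hne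
  obtain ⟨z, hz, hz0⟩ := A.exists_rank_eq_zero (t + A.half) hne
  have h1 := A.rank_add_half t hx
  have h2 := A.rank_add_half t hy
  have hxy : x ≠ y := by rintro rfl; omega
  have hxz : x ≠ z := by rintro rfl; omega
  have hyz : y ≠ z := by rintro rfl; omega
  have ex : A.Extreme S x := ⟨hx, 0, hx0⟩
  have ey : A.Extreme S y := ⟨hy, t, hy0⟩
  have ez : A.Extreme S z := ⟨hz, _, hz0⟩
  by_cases hxp : x = p
  · by_cases hyq : y = q
    · exact ⟨z, fun h => hxz (hxp.trans h.symm), fun h => hyz (hyq.trans h.symm), ez⟩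
    · exact ⟨y, fun h => hxy (hxp.trans h.symm), hyq, ey⟩
  · by_cases hxq : x = q
    · by_cases hyp : y = p
      · exact ⟨z, fun h => hyz (hyp.trans h.symm), fun h => hxz (hxq.trans h.symm), ez⟩
      · exact ⟨y, hyp, fun h => hxy (hxq.trans h.symm), ey⟩
    · exact ⟨x, hxp, hxq, ex⟩

/-- During the halfperiod after time `w`, the element `p` stays in the second half of `S`, the
element `q` is in the first half up to time `e` and in the second half afterwards, and the
element `r` is in the second half up to time `d` and in the first half afterwards. -/
structure Balanced (S : Finset (Fin n)) (p q r : Fin n) (w d e : ℤ) : Prop where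
  ne_pq : p ≠ q
  ne_pr : p ≠ r
  ne_qr : q ≠ r
  extreme_p : A.Extreme S p
  extreme_q : A.Extreme S q
  extreme_r : A.Extreme S r
  le_d : w ≤ d
  d_le : d ≤ e
  e_le : e ≤ w + A.half
  p_below : ∀ t, w < t → t ≤ w + A.half → S.card ≤ 2 * A.rank S t p + 1
  q_above : ∀ t, w < t → t ≤ e → 2 * A.rank S t q + 1 ≤ S.card
  q_below : ∀ t, e < t → t ≤ w + A.half → S.card ≤ 2 * A.rank S t q + 1
  r_below : ∀ t, w < t → t ≤ d → S.card ≤ 2 * A.rank S t r + 1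
  r_above : ∀ t, d < t → t ≤ w + A.half → 2 * A.rank S t r + 1 ≤ S.card

theorem Crosses.sub_two_half {A : AllowableSequence n} {x : Fin n} (hx : x ∈ S) {c : ℤ}
    (h : A.Crosses S x c) : A.Crosses S x (c - 2 * A.half) := by
  have key : ∀ t, A.rank S t x = A.rank S (t + 2 * A.half) x := fun t =>
    (A.rank_add_two_half t hx).symm
  refine ⟨fun t h1 h2 => ?_, fun t h1 h2 => ?_, ?_⟩
  · rw [key]; exact h.above _ (by omega) (by omega)
  · rw [key]; exact h.below _ (by omega) (by omega)
  · rw [key]; convert h.strict using 4; ring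

theorem Crosses.add_two_half {A : AllowableSequence n} {x : Fin n} (hx : x ∈ S) {c : ℤ}
    (h : A.Crosses S x c) : A.Crosses S x (c + 2 * A.half) := by
  have key : ∀ t, A.rank S t x = A.rank S (t - 2 * A.half) x := fun t => by
    rw [← A.rank_add_two_half (t - 2 * A.half) hx, sub_add_cancel]
  refine ⟨fun t h1 h2 => ?_, fun t h1 h2 => ?_, ?_⟩
  · rw [key]; exact h.above _ (by omega) (by omega)
  · rw [key]; exact h.below _ (by omega) (by omega)
  · rw [key]; convert h.strict using 4; ring

theorem rank_add_int_mul_two_half (m : ℤ) (t : ℤ) {x : Fin n} (hx : x ∈ S) :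
    A.rank S (t + m * (2 * A.half)) x = A.rank S t x := by
  induction m using Int.induction_on with
  | zero => simp
  | succ i ih => rw [← ih, add_one_mul, ← add_assoc, A.rank_add_two_half _ hx]
  | pred i ih =>
    rw [← ih, ← A.rank_add_two_half (t + (-(i : ℤ) - 1) * (2 * A.half)) hx]
    congr 1
    ring

theorem Extreme.exists_crosses_near {A : AllowableSequence n} {x : Fin n} (hx : A.Extreme S x)
    (hS : 2 ≤ S.card) (w : ℤ) :
    ∃ c, w - A.half < c ∧ c ≤ w + A.half ∧ A.Crosses S x c := by
  obtain ⟨hx, s, hs⟩ := hx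
  have hhalf : 0 < A.half := by
    obtain ⟨y, hy, z, hz, h⟩ := Finset.one_lt_card.1 (by omega : 1 < S.card)
    exact A.half_pos h
  obtain ⟨m, hm1, hm2⟩ : ∃ m : ℤ, w - A.half < s + m * (2 * A.half) ∧
      s + m * (2 * A.half) ≤ w + A.half := by
    refine ⟨(w + A.half - s) / (2 * A.half), ?_, ?_⟩
    · have := Int.lt_ediv_add_one_mul_self (w + A.half - s) (by omega : 0 < 2 * A.half)
      rw [add_one_mul] at this
      omega
    · have := Int.ediv_mul_le (w + A.half - s) (by omega : 2 * A.half ≠ 0)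
      omega
  obtain ⟨c, h1, h2, h3⟩ := A.exists_crosses hx
    ((A.rank_add_int_mul_two_half m s hx).trans hs) hS
  rcases le_or_gt c (w + A.half) with h4 | h4
  · exact ⟨c, by omega, h4, h3⟩
  · exact ⟨c - 2 * A.half, by omega, by omega, h3.sub_two_half hx⟩

/-- Each extreme element crosses the middle downward at c and upward at c ± `half`. The three are
picked so that, in a window opened by a downward crossing of p, the upward crossing of r does not
come after the downward crossing of q. -/
theorem exists_balanced (hS : 3 ≤ S.card) :
    ∃ p q r w d e, A.Balanced S p q r w d e := by
  classical
  have hne : S.Nonempty := Finset.card_pos.1 (by omega)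
  obtain ⟨p, hp, hp0⟩ := A.exists_rank_eq_zero 0 hne
  obtain ⟨w, -, -, hpw⟩ := A.exists_crosses hp hp0 (by omega)
  -- The last downward crossing of an extreme element after w, within a halfperiod; the element in
  -- front at time w + 1 shows that there is one.
  obtain ⟨e, he, hmax⟩ := ((Finset.Ioc w (w + A.half)).filter
    fun c => ∃ x, A.Extreme S x ∧ A.Crosses S x c).exists_max_image id (by
      obtain ⟨x, hx, hx0⟩ := A.exists_rank_eq_zero (w + 1) hne
      obtain ⟨c, h1, h2, h3⟩ := A.exists_crosses hx hx0 (by omega)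
      refine ⟨c, ?_⟩
      simp only [Finset.mem_filter, Finset.mem_Ioc]
      exact ⟨⟨by omega, by omega⟩, x, ⟨hx, _, hx0⟩, h3⟩)
  simp only [Finset.mem_filter, Finset.mem_Ioc, id] at he hmax
  obtain ⟨⟨hwe, hew⟩, q, hq, hqe⟩ := he
  have hpq : p ≠ q := by
    rintro rfl
    have := hpw.lt_of_lt hqe hwe
    omega
  have hpE : A.Extreme S p := ⟨hp, 0, hp0⟩
  rcases hew.lt_or_eq with hlt | rfl
  -- The element in front just after e crosses downward too late to be in the window, by maximality
  -- of e, so its upward crossing a halfperiod earlier lies between w and e.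
  · obtain ⟨r, hr, hr0⟩ := A.exists_rank_eq_zero (e + 1) hne
    obtain ⟨c, h1, h2, hrc⟩ := A.exists_crosses hr hr0 (by omega)
    have hrE : A.Extreme S r := ⟨hr, _, hr0⟩
    have hcw : w + A.half < c := by
      by_contra hle
      have := hmax c ⟨⟨by omega, by omega⟩, r, hrE, hrc⟩
      omega
    have hpr : p ≠ r := by
      rintro rfl
      have := hpw.below (e + 1) (by omega) (by omega)
      omega
    have hqr : q ≠ r := by
      rintro rfl
      have := hqe.below (e + 1) (by omega) (by omega)
      omega
    refine ⟨p, q, r, w, c - A.half, e, hpq, hpr, hqr, hpE, hq, hrE, by omega, by omega, by omega,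
      hpw.below, fun t h1 h2 => hqe.above t (by omega) h2, fun t h1 h2 => hqe.below t h1 (by omega),
      fun t h3 h4 => ?_, fun t h3 h4 => hrc.above t (by omega) (by omega)⟩
    have h5 := A.rank_add_half t hr
    have h6 := hrc.above (t + A.half) (by omega) (by omega)
    omega
  -- Now p and q cross exactly a halfperiod apart, and any third extreme element will do. If it
  -- crosses downward after w, the window is moved back by a halfperiod and p and q trade roles.
  · obtain ⟨r, hrp, hrq, hr⟩ := A.exists_extreme_ne_ne hS p q
    obtain ⟨c, h1, h2, hrc⟩ := hr.exists_crosses_near (by omega) w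
    rcases le_or_gt c w with h3 | h3
    · refine ⟨p, q, r, w, c + A.half, w + A.half, hpq, hrp.symm, hrq.symm, hpE, hq, hr, by omega,
        by omega, by omega, hpw.below, fun t h1 h2 => hqe.above t (by omega) h2,
        fun t h1 h2 => by omega, fun t h4 h5 => hrc.below t (by omega) (by omega),
        fun t h4 h5 => (hrc.add_two_half hr.1).above t (by omega) (by omega)⟩
    · refine ⟨q, p, r, w - A.half, c - A.half, w, hpq.symm, hrq.symm, hrp.symm, hq, hpE, hr,
        by omega, by omega, by omega,
        fun t h4 h5 => (hqe.sub_two_half hq.1).below t (by omega) (by omega),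
        fun t h4 h5 => hpw.above t (by omega) h5, fun t h4 h5 => by omega,
        fun t h4 h5 => (hrc.sub_two_half hr.1).below t (by omega) (by omega),
        fun t h4 h5 => hrc.above t (by omega) (by omega)⟩

end AllowableSequence

/-! ### The additional transpositions at gate κ - 1 -/

namespace AllowableSequence

variable {n : ℕ} (A : AllowableSequence n) {S : Finset (Fin n)}

/-- The first `j` elements of `S` in the `t`-th permutation. -/
def first (S : Finset (Fin n)) (j : ℕ) (t : ℤ) : Finset (Fin n) :=
  S.filter fun x => A.rank S t x < j

theorem mem_first {j : ℕ} {t : ℤ} {x : Fin n} :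
    x ∈ A.first S j t ↔ x ∈ S ∧ A.rank S t x < j := Finset.mem_filter

theorem first_subset (j : ℕ) (t : ℤ) : A.first S j t ⊆ S := Finset.filter_subset _ _

theorem card_first {j : ℕ} (hj : j ≤ S.card) (t : ℤ) : (A.first S j t).card = j := by
  have himage : S.image (A.rank S t) = Finset.range S.card := by
    apply Finset.eq_of_subset_of_card_le
    · intro i hi
      obtain ⟨x, hx, rfl⟩ := Finset.mem_image.1 hi
      exact Finset.mem_range.2 (A.rank_lt_card hx)
    · rw [Finset.card_image_of_injOn (A.rank_injOn t), Finset.card_range]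
  have h2 : (A.first S j t).image (A.rank S t) = Finset.range j := by
    ext i
    simp only [Finset.mem_image, mem_first, Finset.mem_range]
    constructor
    · rintro ⟨x, hx, rfl⟩
      exact hx.2
    · intro hi
      have : i ∈ S.image (A.rank S t) := by
        rw [himage]; exact Finset.mem_range.2 (by omega)
      obtain ⟨x, hx, rfl⟩ := Finset.mem_image.1 this
      exact ⟨x, ⟨hx, hi⟩, rfl⟩
  have h3 := Finset.card_image_of_injOn
    ((A.rank_injOn t).mono (fun x hx => A.first_subset (S := S) j t hx))
  rw [← h3, h2, Finset.card_range]

/-- Only a transposition at gate j alters the set of the first j elements, and it trades a single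
element for another. -/
theorem first_sdiff_succ_subset {j : ℕ} {t : ℤ} :
    A.first S j t \ A.first S j (t + 1) ⊆ {A.hi t} ∧
    A.first S j (t + 1) \ A.first S j t ⊆ {A.lo t} ∧
    (¬ (A.Within S t ∧ A.gate S t = j) → A.first S j (t + 1) = A.first S j t) := by
  have key : ∀ x ∈ S, x ≠ A.hi t → x ≠ A.lo t → A.rank S (t + 1) x = A.rank S t x :=
    fun x hx h1 h2 => A.rank_succ_of_ne (fun _ => ⟨h1, h2⟩) hx
  by_cases hw : A.Within S t
  · have h1 := A.rank_succ_hi hw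
    have h2 := A.rank_succ_lo (S := S) t
    have h3 := A.rank_lo hw
    refine ⟨fun x hx => ?_, fun x hx => ?_, fun h => ?_⟩
    · rw [Finset.mem_sdiff, mem_first, mem_first] at hx
      rw [Finset.mem_singleton]
      by_contra h4
      by_cases h5 : x = A.lo t
      · subst h5
        exact hx.2 ⟨hx.1.1, by omega⟩
      · exact hx.2 ⟨hx.1.1, by rw [key x hx.1.1 h4 h5]; exact hx.1.2⟩
    · rw [Finset.mem_sdiff, mem_first, mem_first] at hx
      rw [Finset.mem_singleton]
      by_contra h4
      by_cases h5 : x = A.hi t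
      · subst h5
        exact hx.2 ⟨hx.1.1, by omega⟩
      · exact hx.2 ⟨hx.1.1, by rw [← key x hx.1.1 h5 h4]; exact hx.1.2⟩
    · have hg : A.rank S t (A.hi t) + 1 ≠ j := fun h' => h ⟨hw, h'⟩
      ext x
      rw [mem_first, mem_first]
      refine and_congr_right fun hx => ?_
      by_cases h4 : x = A.hi t
      · subst h4; omega
      · by_cases h5 : x = A.lo t
        · subst h5; omega
        · rw [key x hx h4 h5]
  · have : A.first S j (t + 1) = A.first S j t := by
      ext x
      rw [mem_first, mem_first]
      refine and_congr_right fun hx => ?_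
      rw [A.rank_succ_of_ne (fun h => absurd h hw) hx]
    simp [this]

theorem card_first_sdiff_le {j : ℕ} {s t : ℤ} (hst : s ≤ t) :
    (A.first S j s \ A.first S j t).card
      ≤ countIco (fun i => A.Within S i ∧ A.gate S i = j) s t ∧
    (A.first S j t \ A.first S j s).card
      ≤ countIco (fun i => A.Within S i ∧ A.gate S i = j) s t := by
  classical
  induction t, hst using Int.leInduction with
  | base => simp
  | succ t hst ih =>
    rw [countIco_succ _ hst]
    obtain ⟨h1, h2, h3⟩ := A.first_sdiff_succ_subset (S := S) (j := j) (t := t)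
    split_ifs with h
    · constructor
      · have hsub : A.first S j s \ A.first S j (t + 1) ⊆
            (A.first S j s \ A.first S j t) ∪ {A.hi t} := by
          intro x hx
          rw [Finset.mem_sdiff] at hx
          by_cases hx2 : x ∈ A.first S j t
          · exact Finset.mem_union_right _ (h1 (Finset.mem_sdiff.2 ⟨hx2, hx.2⟩))
          · exact Finset.mem_union_left _ (Finset.mem_sdiff.2 ⟨hx.1, hx2⟩)
        refine (Finset.card_le_card hsub).trans ((Finset.card_union_le _ _).trans ?_)
        rw [Finset.card_singleton]
        omega
      · have hsub : A.first S j (t + 1) \ A.first S j s ⊆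
            (A.first S j t \ A.first S j s) ∪ {A.lo t} := by
          intro x hx
          rw [Finset.mem_sdiff] at hx
          by_cases hx2 : x ∈ A.first S j t
          · exact Finset.mem_union_left _ (Finset.mem_sdiff.2 ⟨hx2, hx.2⟩)
          · exact Finset.mem_union_right _ (h2 (Finset.mem_sdiff.2 ⟨hx.1, hx2⟩))
        refine (Finset.card_le_card hsub).trans ((Finset.card_union_le _ _).trans ?_)
        rw [Finset.card_singleton]
        omega
    · rw [h3 h]
      omega

/-- Of any `k` elements that lead at the start, stay or return on the prescribed sides at the three
pieces of a halfperiod, no element serves twice. -/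
theorem three_mul_le_card_add_countIco {k : ℕ} (hk : 2 * k ≤ S.card) {w d e : ℤ} (hwd : w ≤ d)
    (hde : d ≤ e) (hew : e ≤ w + A.half) :
    3 * k ≤ S.card + countIco (fun t => A.Within S t ∧
      ((A.gate S t = k ∧ ¬ (d ≤ t ∧ t < e)) ∨ (A.gate S t + k = S.card ∧ d ≤ t ∧ t < e)))
      w (w + A.half) := by
  classical
  rw [← countIco_append _ hwd (hde.trans hew), ← countIco_append _ hde hew]
  have c1 : countIco (fun t => A.Within S t ∧ A.gate S t = k) w d ≤
      countIco (fun t => A.Within S t ∧ ((A.gate S t = k ∧ ¬ (d ≤ t ∧ t < e)) ∨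
        (A.gate S t + k = S.card ∧ d ≤ t ∧ t < e))) w d :=
    countIco_mono fun t h1 h2 h3 => ⟨h3.1, Or.inl ⟨h3.2, by omega⟩⟩
  have c2 : countIco (fun t => A.Within S t ∧ A.gate S t = S.card - k) d e ≤
      countIco (fun t => A.Within S t ∧ ((A.gate S t = k ∧ ¬ (d ≤ t ∧ t < e)) ∨
        (A.gate S t + k = S.card ∧ d ≤ t ∧ t < e))) d e :=
    countIco_mono fun t h1 h2 h3 => ⟨h3.1, Or.inr ⟨by omega, h1, h2⟩⟩
  have c3 : countIco (fun t => A.Within S t ∧ A.gate S t = k) e (w + A.half) ≤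
      countIco (fun t => A.Within S t ∧ ((A.gate S t = k ∧ ¬ (d ≤ t ∧ t < e)) ∨
        (A.gate S t + k = S.card ∧ d ≤ t ∧ t < e))) e (w + A.half) :=
    countIco_mono fun t h1 h2 h3 => ⟨h3.1, Or.inl ⟨h3.2, by omega⟩⟩
  have a1 := (A.card_first_sdiff_le (S := S) (j := k) hwd).1
  have a2 := (A.card_first_sdiff_le (S := S) (j := S.card - k) hde).2
  have a3 := (A.card_first_sdiff_le (S := S) (j := k) hew).1
  have b1 := Finset.card_inter_add_card_sdiff (A.first S k w) (A.first S k d)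
  have b3 := Finset.card_inter_add_card_sdiff (A.first S k e) (A.first S k (w + A.half))
  rw [A.card_first (by omega)] at b1 b3
  -- The last k elements are handled as the complement of the first |S| - k.
  have b2 : S.card - k + (A.first S (S.card - k) e \ A.first S (S.card - k) d).card + (S \ (A.first S (S.card - k) d ∪ A.first S (S.card - k) e)).card
      = S.card := by
    have h1 := Finset.card_sdiff_add_card_eq_card (Finset.union_subset
      (A.first_subset (S := S) (S.card - k) d) (A.first_subset (S := S) (S.card - k) e))
    rw [← Finset.union_sdiff_self_eq_union, Finset.card_union_of_disjoint Finset.disjoint_sdiff,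
      A.card_first (by omega), Finset.union_sdiff_self_eq_union] at h1
    omega
  -- X leads at w and d, Y trails at d and e, Z leads at e and at the end, hence trails at w. Any
  -- two of these sets are opposed at a common time, so they are disjoint as 2k ≤ |S|. Each has at
  -- least k elements minus the crossings in its own piece.
  set X := A.first S k w ∩ A.first S k d with hX
  set Y := S \ (A.first S (S.card - k) d ∪ A.first S (S.card - k) e) with hY
  set Z := A.first S k e ∩ A.first S k (w + A.half) with hZ
  have d12 : Disjoint X Y := by
    rw [Finset.disjoint_left]
    intro x hx hy
    simp only [hX, hY, Finset.mem_inter, Finset.mem_sdiff, Finset.mem_union, mem_first] at hx hy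
    exact hy.2 (Or.inl ⟨hy.1, by omega⟩)
  have d3 : Disjoint (X ∪ Y) Z := by
    rw [Finset.disjoint_left]
    intro x hxy hz
    simp only [hX, hY, hZ, Finset.mem_inter, Finset.mem_sdiff, Finset.mem_union, mem_first] at hxy hz
    rcases hxy with hx | hy
    · have := A.rank_add_half w hx.1.1
      omega
    · exact hy.2 (Or.inr ⟨hy.1, by omega⟩)
  have hle : ((X ∪ Y) ∪ Z).card ≤ S.card := by
    apply Finset.card_le_card
    intro x hx
    simp only [hX, hY, hZ, Finset.mem_inter, Finset.mem_sdiff, Finset.mem_union, mem_first] at hx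
    tauto
  rw [Finset.card_union_of_disjoint d3, Finset.card_union_of_disjoint d12] at hle
  omega

theorem rank_erase {u : Fin n} (hu : u ∈ S) (t : ℤ) (x : Fin n) :
    A.rank S t x = A.rank (S.erase u) t x + if A.pos t u < A.pos t x then 1 else 0 := by
  rw [rank, rank, Finset.filter_erase]
  split_ifs with h
  · rw [Finset.card_erase_add_one (Finset.mem_filter.2 ⟨hu, h⟩)]
  · rw [Finset.erase_eq_of_notMem (by simp [h]), add_zero]

/-- Restoring p, q, r moves a gate away from an end by the number of them on that side of it. The
half at that end holds at most two of them, and just one where gate κ - 1 is admitted. If more lie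
on that side, the gate is past the middle and is outer from the other end. -/
theorem Balanced.outer_of_gate {A : AllowableSequence n} {p q r : Fin n} {w d e : ℤ}
    (h : A.Balanced S p q r w d e) {κ : ℕ} {t : ℤ} (hwt : w < t)
    (ht : t ≤ w + A.half) (hw : A.Within (((S.erase p).erase q).erase r) t)
    (hg : A.gate (((S.erase p).erase q).erase r) t ≤ κ - 2 ∨
      (((S.erase p).erase q).erase r).card ≤ A.gate (((S.erase p).erase q).erase r) t + (κ - 2) ∨
      (A.gate (((S.erase p).erase q).erase r) t = κ - 1 ∧ ¬ (d < t ∧ t ≤ e)) ∨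
      (A.gate (((S.erase p).erase q).erase r) t + (κ - 1) = (((S.erase p).erase q).erase r).card ∧
        d < t ∧ t ≤ e)) :
    A.Outer S κ t := by
  have hp := h.extreme_p.1
  have hq := h.extreme_q.1
  have hr := h.extreme_r.1
  have hq' : q ∈ S.erase p := Finset.mem_erase.2 ⟨h.ne_pq.symm, hq⟩
  have hr' : r ∈ (S.erase p).erase q :=
    Finset.mem_erase.2 ⟨h.ne_qr.symm, Finset.mem_erase.2 ⟨h.ne_pr.symm, hr⟩⟩
  have hcard : (((S.erase p).erase q).erase r).card + 3 = S.card := by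
    have := Finset.card_erase_add_one hr'
    have := Finset.card_erase_add_one hq'
    have := Finset.card_erase_add_one hp
    omega
  have hgpos := A.gate_pos (S := ((S.erase p).erase q).erase r) t
  have hglt := A.gate_lt_card hw
  have hwS : A.Within S t := by
    have := hw
    simp only [Within, Finset.mem_erase] at this
    exact ⟨this.1.2.2.2, this.2.2.2.2⟩
  have h1 := A.rank_erase hp t (A.hi t)
  have h2 := A.rank_erase hq' t (A.hi t)
  have h3 := A.rank_erase hr' t (A.hi t)
  simp only [← A.rank_lt_iff hp hwS.1, ← A.rank_lt_iff hq hwS.1, ← A.rank_lt_iff hr hwS.1]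
    at h1 h2 h3
  have npq : A.rank S t p ≠ A.rank S t q := fun h' => h.ne_pq (A.rank_injOn t hp hq h')
  have npr : A.rank S t p ≠ A.rank S t r := fun h' => h.ne_pr (A.rank_injOn t hp hr h')
  have nqr : A.rank S t q ≠ A.rank S t r := fun h' => h.ne_qr (A.rank_injOn t hq hr h')
  have key : ∀ u ∈ S, u ∉ ((S.erase p).erase q).erase r → A.rank S t u ≠ A.rank S t (A.hi t) ∧
      A.rank S t u ≠ A.rank S t (A.hi t) + 1 := by
    intro u hu hu'
    rw [← A.rank_lo hwS]
    constructor
    · intro h'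
      rw [A.rank_injOn t hu hwS.1 h'] at hu'
      exact hu' hw.1
    · intro h'
      rw [A.rank_injOn t hu hwS.2 h'] at hu'
      exact hu' hw.2
  have kp := key p hp (by simp)
  have kq := key q hq (by simp)
  have kr := key r hr (by simp)
  refine ⟨hwS, ?_⟩
  have vp := h.p_below t hwt ht
  -- Between d and e both q and r join the first half; otherwise exactly one of them does. The
  -- element p is always in the second half.
  have hv : ((d < t ∧ t ≤ e) ∧ 2 * A.rank S t q + 1 ≤ S.card ∧
      2 * A.rank S t r + 1 ≤ S.card) ∨
      (¬ (d < t ∧ t ≤ e) ∧ ((2 * A.rank S t q + 1 ≤ S.card ∧ S.card ≤ 2 * A.rank S t r + 1) ∨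
        (S.card ≤ 2 * A.rank S t q + 1 ∧ 2 * A.rank S t r + 1 ≤ S.card))) := by
    have hde := h.d_le
    rcases le_or_gt t d with hd | hd
    · exact Or.inr ⟨by omega, Or.inl ⟨h.q_above t hwt (by omega), h.r_below t hwt hd⟩⟩
    · rcases le_or_gt t e with he | he
      · exact Or.inl ⟨⟨hd, he⟩, h.q_above t hwt he, h.r_above t hd ht⟩
      · exact Or.inr ⟨by omega, Or.inr ⟨h.q_below t he ht, h.r_above t hd ht⟩⟩
  have hg' : A.gate (((S.erase p).erase q).erase r) t ≤ κ - 2 ∨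
      (((S.erase p).erase q).erase r).card ≤ A.gate (((S.erase p).erase q).erase r) t + (κ - 2) ∨
      (A.gate (((S.erase p).erase q).erase r) t = κ - 1 ∧ ¬ (d < t ∧ t ≤ e)) ∨
      (A.gate (((S.erase p).erase q).erase r) t + (κ - 1) = (((S.erase p).erase q).erase r).card ∧
        (d < t ∧ t ≤ e)) := hg
  generalize (d < t ∧ t ≤ e) = D at hv hg'
  simp only [gate] at hg' hgpos hglt ⊢
  generalize (((S.erase p).erase q).erase r).card = n' at *
  generalize A.rank (((S.erase p).erase q).erase r) t (A.hi t) = g at *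
  generalize A.rank ((S.erase p).erase q) t (A.hi t) = g2 at *
  generalize A.rank (S.erase p) t (A.hi t) = g1 at *
  generalize A.rank S t (A.hi t) = g0 at *
  generalize A.rank S t p = rp at *
  generalize A.rank S t q = rq at *
  generalize A.rank S t r = rr at *
  generalize S.card = m at *
  clear key hwS hw h hp hq hr hq' hr' hg
  by_cases hD : D <;> simp only [hD, not_true_eq_false, not_false_eq_true, and_true, and_false,
    true_and, false_and, or_false, false_or] at hv hg' <;> split_ifs at h1 h2 h3 <;> omega

end AllowableSequence

theorem exists_finset_card_eq_countIco (Q : ℤ → Prop) (a b : ℤ) :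
    ∃ F : Finset ℤ, (∀ t, t ∈ F ↔ (a ≤ t ∧ t < b) ∧ Q t) ∧ F.card = countIco Q a b := by
  classical
  exact ⟨(Finset.Ico a b).filter Q, by simp, by rw [countIco]⟩

/-! ### The quadratic lower bound for outer transpositions -/

namespace AllowableSequence

variable {n : ℕ} (A : AllowableSequence n) {S : Finset (Fin n)}

theorem card_swapped_mem_and_mem_le_one {p q : Fin n} (hpq : p ≠ q) {s : ℤ} {F : Finset ℤ}
    (hF : ∀ t ∈ F, (s ≤ t ∧ t < s + A.half) ∧ p ∈ A.swapped t ∧ q ∈ A.swapped t) : F.card ≤ 1 := by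
  rw [Finset.card_le_one]
  intro t ht t' ht'
  obtain ⟨⟨h1, h2⟩, h3⟩ := hF t ht
  obtain ⟨⟨h1', h2'⟩, h3'⟩ := hF t' ht'
  rw [Sym2.mem_and_mem_iff hpq] at h3 h3'
  exact A.swapped_inj h1 h2 h1' h2' (h3.trans h3'.symm)

/-- Inclusion and exclusion: each of the three accounts for 2κ, and each two of them share at most
the transposition that interchanges them. -/
theorem six_mul_le_countIco_outer {p q r : Fin n} (hpq : p ≠ q) (hpr : p ≠ r) (hqr : q ≠ r)
    (hp : A.Extreme S p) (hq : A.Extreme S q) (hr : A.Extreme S r) {κ : ℕ}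
    (hκ : 2 * κ < S.card) (s : ℤ) :
    6 * κ ≤ countIco (fun t => A.Outer S κ t ∧ (p ∈ A.swapped t ∨ q ∈ A.swapped t ∨
      r ∈ A.swapped t)) s (s + A.half) + 3 := by
  classical
  have h1 := A.two_mul_le_countIco_outer hp hκ s
  have h2 := A.two_mul_le_countIco_outer hq hκ s
  have h3 := A.two_mul_le_countIco_outer hr hκ s
  obtain ⟨P, mp, hP⟩ := exists_finset_card_eq_countIco
    (fun t => A.Outer S κ t ∧ p ∈ A.swapped t) s (s + A.half)
  obtain ⟨Q, mq, hQ⟩ := exists_finset_card_eq_countIco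
    (fun t => A.Outer S κ t ∧ q ∈ A.swapped t) s (s + A.half)
  obtain ⟨R, mr, hR⟩ := exists_finset_card_eq_countIco
    (fun t => A.Outer S κ t ∧ r ∈ A.swapped t) s (s + A.half)
  obtain ⟨F, mem', hF⟩ := exists_finset_card_eq_countIco
    (fun t => A.Outer S κ t ∧ (p ∈ A.swapped t ∨ q ∈ A.swapped t ∨ r ∈ A.swapped t))
    s (s + A.half)
  rw [← hP] at h1
  rw [← hQ] at h2
  rw [← hR] at h3
  rw [← hF]
  have c1 : (P ∩ Q).card ≤ 1 := A.card_swapped_mem_and_mem_le_one hpq (s := s) fun t ht => by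
    rw [Finset.mem_inter, mp, mq] at ht
    exact ⟨ht.1.1, ht.1.2.2, ht.2.2.2⟩
  have c2 : (P ∩ R).card ≤ 1 := A.card_swapped_mem_and_mem_le_one hpr (s := s) fun t ht => by
    rw [Finset.mem_inter, mp, mr] at ht
    exact ⟨ht.1.1, ht.1.2.2, ht.2.2.2⟩
  have c3 : (Q ∩ R).card ≤ 1 := A.card_swapped_mem_and_mem_le_one hqr (s := s) fun t ht => by
    rw [Finset.mem_inter, mq, mr] at ht
    exact ⟨ht.1.1, ht.1.2.2, ht.2.2.2⟩
  have e1 := Finset.card_union_add_card_inter P Q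
  have e2 := Finset.card_union_add_card_inter (P ∪ Q) R
  rw [Finset.union_inter_distrib_right] at e2
  have e3 := Finset.card_union_le (P ∩ R) (Q ∩ R)
  have e4 : ((P ∪ Q) ∪ R).card ≤ F.card := by
    apply Finset.card_le_card
    intro t ht
    rw [Finset.mem_union, Finset.mem_union, mp, mq, mr] at ht
    rw [mem']
    tauto
  omega

/-- Outer transpositions of S either involve p, q or r, which gives 6κ - 3, or lie within the rest.
The latter include those at the outer κ - 2 gates of the rest and, disjointly, the extra ones at
gate κ - 1. The difference 3κ - |S| is truncated, so it claims nothing when |S| > 3κ. -/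
theorem exists_countIco_outer_ge {κ : ℕ} (hκ : 1 ≤ κ) (hS : 2 * κ < S.card) :
    ∃ S' : Finset (Fin n), S'.card + 3 = S.card ∧
      countIco (A.Outer S' (κ - 2)) 0 (0 + A.half) + 6 * κ + (3 * κ - S.card) ≤
        countIco (A.Outer S κ) 0 (0 + A.half) + 3 := by
  obtain ⟨p, q, r, w, d, e, h⟩ := A.exists_balanced (by omega : 3 ≤ S.card)
  have hq' : q ∈ S.erase p := Finset.mem_erase.2 ⟨h.ne_pq.symm, h.extreme_q.1⟩
  have hr' : r ∈ (S.erase p).erase q :=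
    Finset.mem_erase.2 ⟨h.ne_qr.symm, Finset.mem_erase.2 ⟨h.ne_pr.symm, h.extreme_r.1⟩⟩
  have hcard : (((S.erase p).erase q).erase r).card + 3 = S.card := by
    have := Finset.card_erase_add_one hr'
    have := Finset.card_erase_add_one hq'
    have := Finset.card_erase_add_one h.extreme_p.1
    omega
  refine ⟨((S.erase p).erase q).erase r, hcard, ?_⟩
  rw [countIco_shift A.half_nonneg (A.outer_add_half _) 0 (w + 1),
    countIco_shift A.half_nonneg (A.outer_add_half _) 0 (w + 1)]
  have h6 := A.six_mul_le_countIco_outer h.ne_pq h.ne_pr h.ne_qr h.extreme_p h.extreme_q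
    h.extreme_r hS (w + 1)
  -- The intervals of `Balanced` are open on the left and closed on the right, while `countIco` is
  -- the opposite; hence the shift by one.
  have hgain := A.three_mul_le_card_add_countIco (S := ((S.erase p).erase q).erase r)
    (k := κ - 1) (by omega) (w := w + 1) (d := d + 1) (e := e + 1) (by linarith [h.le_d])
    (by linarith [h.d_le]) (by linarith [h.e_le])
  have hmid := countIco_add_le (a := w + 1) (b := w + 1 + A.half)
    (Q := A.Outer (((S.erase p).erase q).erase r) (κ - 2))
    (R := fun t => A.Within (((S.erase p).erase q).erase r) t ∧
      ((A.gate (((S.erase p).erase q).erase r) t = κ - 1 ∧ ¬ (d + 1 ≤ t ∧ t < e + 1)) ∨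
      (A.gate (((S.erase p).erase q).erase r) t + (κ - 1) = (((S.erase p).erase q).erase r).card ∧
        d + 1 ≤ t ∧ t < e + 1)))
    (U := fun t => A.Outer S κ t ∧ A.Within (((S.erase p).erase q).erase r) t)
    (fun t h1 h2 ht => ⟨h.outer_of_gate (by omega) (by omega) ht.1 (by
      rcases ht.2 with h3 | h3
      · exact Or.inl h3
      · exact Or.inr (Or.inl h3)), ht.1⟩)
    (fun t h1 h2 ht => ⟨h.outer_of_gate (by omega) (by omega) ht.1 (by
      rcases ht.2 with h3 | h3
      · exact Or.inr (Or.inr (Or.inl ⟨h3.1, by omega⟩))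
      · exact Or.inr (Or.inr (Or.inr ⟨h3.1, by omega⟩))), ht.1⟩)
    (fun t h1 h2 ht ht' => by
      have := ht.2
      have := ht'.2
      have := A.gate_pos (S := ((S.erase p).erase q).erase r) t
      have := A.gate_lt_card ht.1
      omega)
  have hall := countIco_add_le (a := w + 1) (b := w + 1 + A.half)
    (Q := fun t => A.Outer S κ t ∧ (p ∈ A.swapped t ∨ q ∈ A.swapped t ∨ r ∈ A.swapped t))
    (R := fun t => A.Outer S κ t ∧ A.Within (((S.erase p).erase q).erase r) t)
    (U := A.Outer S κ) (fun t _ _ ht => ht.1) (fun t _ _ ht => ht.1)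
    (fun t _ _ ht ht' => by
      have h1 := ht'.2
      have h2 := ht.2
      simp only [Within, Finset.mem_erase, swapped, Sym2.mem_iff] at h1 h2
      rcases h2 with (rfl | rfl) | (rfl | rfl) | (rfl | rfl) <;> simp at h1)
  omega

/-- The lower bound for the number of transpositions at the outer `κ` gates of a subset `S`. -/
theorem countIco_outer_ge (κ : ℕ) (hS : 2 * κ < S.card) :
    9 * (κ * (κ + 1) : ℤ) ≤ 6 * countIco (A.Outer S κ) 0 (0 + A.half) ∧
    (S.card ≤ 3 * κ → 9 * (κ * (κ + 1) : ℤ) + (3 * κ - S.card) * (3 * κ - S.card + 3)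
      ≤ 6 * countIco (A.Outer S κ) 0 (0 + A.half)) := by
  induction κ using Nat.strong_induction_on generalizing S with
  | _ κ ih =>
    rcases Nat.lt_or_ge κ 1 with h0 | h0
    · obtain rfl : κ = 0 := by omega
      refine ⟨by simp, fun h => by omega⟩
    · obtain ⟨S', hc, hS'⟩ := A.exists_countIco_outer_ge h0 hS
      rcases Nat.lt_or_ge κ 2 with h2 | h2
      · obtain rfl : κ = 1 := by omega
        refine ⟨by push_cast; omega, fun h => ?_⟩
        have : S.card = 3 := by omega
        rw [this]
        push_cast
        omega
      · obtain ⟨k, rfl⟩ := Nat.exists_eq_add_of_le' h2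
        rw [Nat.add_sub_cancel] at hS'
        obtain ⟨i1, i2⟩ := ih k (by omega) (S := S') (by omega)
        generalize countIco (A.Outer S' k) 0 (0 + A.half) = M' at *
        generalize countIco (A.Outer S (k + 2)) 0 (0 + A.half) = M at *
        constructor
        · have : M' + 6 * (k + 2) ≤ M + 3 := by omega
          zify at this
          push_cast
          nlinarith
        · intro h3
          obtain ⟨z, hz⟩ := Nat.exists_eq_add_of_le h3
          have h4 : M' + 6 * (k + 2) + z ≤ M + 3 := by omega
          zify at h4 hz
          have h5 : (3 * ((k + 2 : ℕ) : ℤ) - S.card) = z := by push_cast; linarith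
          rw [h5]
          -- With z = 3κ - |S|, the recursion adds 6z and z(z + 3) = (z - 3)z + 6z. For z < 3 the
          -- second inductive bound is not available, but z(z + 3) ≤ 6z, so the first one is enough.
          rcases Nat.lt_or_ge z 3 with h6 | h6
          · have h7 : (z : ℤ) * (z + 3) ≤ 6 * z := by
              have : (z : ℤ) ≤ 2 := by omega
              nlinarith
            push_cast
            nlinarith
          · have h7 := i2 (by omega)
            have h8 : (3 * (k : ℤ) - S'.card) = z - 3 := by omega
            rw [h8] at h7
            push_cast
            nlinarith

end AllowableSequence

/-! ### Transpositions inside the center versus across its boundary -/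

namespace AllowableSequence

variable {n : ℕ} (A : AllowableSequence n)

theorem rank_univ (t : ℤ) (x : Fin n) : A.rank Finset.univ t x = A.pos t x := by
  have h : (Finset.univ.filter fun z => A.pos t z < A.pos t x).map (A.perm t).symm.toEmbedding
      = Finset.Iio ((A.perm t).symm x) := by
    ext z
    rw [Finset.mem_map_equiv, Finset.mem_filter, Finset.mem_Iio, Fin.lt_def]
    simp [pos]
  rw [rank, ← Finset.card_map (A.perm t).symm.toEmbedding, h, Fin.card_Iio, pos]

theorem within_univ (t : ℤ) : A.Within Finset.univ t := ⟨Finset.mem_univ _, Finset.mem_univ _⟩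

theorem gate_univ (t : ℤ) : A.gate Finset.univ t = A.pos t (A.hi t) + 1 := by
  rw [gate, rank_univ]

/-- In the `t`-th permutation, `x` is not among the first `κ` nor among the last `κ` elements. -/
def Central (κ : ℕ) (t : ℤ) (x : Fin n) : Prop := κ ≤ A.pos t x ∧ A.pos t x + κ < n

theorem central_add_half {κ : ℕ} {t : ℤ} {x : Fin n} :
    A.Central κ (t + A.half) x ↔ A.Central κ t x := by
  have := A.pos_add_half t x
  rw [Central, Central]
  omega

theorem central_add_mul_half {κ : ℕ} (m t : ℤ) {x : Fin n} :
    A.Central κ (t + m * A.half) x ↔ A.Central κ t x := by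
  induction m using Int.induction_on with
  | zero => simp
  | succ i ih => rw [← ih, add_one_mul, ← add_assoc, central_add_half]
  | pred i ih =>
    rw [← ih, ← A.central_add_half (t := t + (-(i : ℤ) - 1) * A.half)]
    rw [show t + (-(i : ℤ) - 1) * A.half + A.half = t + -(i : ℤ) * A.half by ring]

/-- The `t`-th transposition moves `x` into the center. -/
def Enters (κ : ℕ) (t : ℤ) (x : Fin n) : Prop := ¬ A.Central κ t x ∧ A.Central κ (t + 1) x

/-- The `t`-th transposition exchanges an element of the center with one outside. -/
def Boundary (κ : ℕ) (t : ℤ) : Prop :=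
  A.gate Finset.univ t = κ ∨ A.gate Finset.univ t + κ = n

/-- The `t`-th transposition exchanges two elements of the center. -/
def Inner (κ : ℕ) (t : ℤ) : Prop :=
  κ < A.gate Finset.univ t ∧ A.gate Finset.univ t + κ < n

variable {A}

theorem Enters.eq_or_eq {κ : ℕ} {t : ℤ} {x : Fin n} (h : A.Enters κ t x) :
    (x = A.hi t ∧ A.gate Finset.univ t = κ) ∨ (x = A.lo t ∧ A.gate Finset.univ t + κ = n) := by
  have h1 := A.pos_lo t
  have h2 := A.pos_succ_hi t
  have h3 := A.pos_succ_lo t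
  rw [Enters, Central, Central] at h
  rw [gate_univ]
  by_cases hx : x = A.hi t
  · subst hx
    exact Or.inl ⟨rfl, by omega⟩
  · by_cases hx' : x = A.lo t
    · subst hx'
      exact Or.inr ⟨rfl, by omega⟩
    · rw [A.pos_succ_of_ne hx hx'] at h
      tauto

theorem Enters.boundary {κ : ℕ} {t : ℤ} {x : Fin n} (h : A.Enters κ t x) : A.Boundary κ t :=
  h.eq_or_eq.imp And.right And.right

theorem Enters.unique {κ : ℕ} {t : ℤ} {x y : Fin n} (h : A.Enters κ t x)
    (h' : A.Enters κ t y) : x = y := by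
  have h1 := A.pos_lo t
  have h2 := A.pos_succ_hi t
  have h3 := A.pos_succ_lo t
  rcases h.eq_or_eq with ⟨rfl, e⟩ | ⟨rfl, e⟩ <;> rcases h'.eq_or_eq with ⟨rfl, e'⟩ | ⟨rfl, e'⟩
  · rfl
  · rw [Enters, Central, Central] at h h'
    omega
  · rw [Enters, Central, Central] at h h'
    omega
  · rfl

variable (A)

theorem exists_enters {κ : ℕ} {t u : ℤ} {x : Fin n} (hu : ¬ A.Central κ u x)
    (ht : A.Central κ t x) (hn : 0 < A.half) :
    ∃ e, e < t ∧ A.Enters κ e x ∧ ∀ i, e < i → i ≤ t → A.Central κ i x := by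
  classical
  obtain ⟨u', hu', hlt⟩ : ∃ u', ¬ A.Central κ u' x ∧ u' < t := by
    -- Being central is invariant under the reversal, so u may be moved back by halfperiods until it
    -- precedes t.
    refine ⟨u + (-(|u - t| + 1)) * A.half, by rwa [central_add_mul_half], ?_⟩
    have := le_abs_self (u - t)
    have := abs_nonneg (u - t)
    nlinarith
  obtain ⟨e, he, hmax⟩ := ((Finset.Ico u' t).filter
    fun i => ¬ A.Central κ i x).exists_max_image id ⟨u', by simp [hu', hlt]⟩
  simp only [Finset.mem_filter, Finset.mem_Ico, id] at he hmax
  have key : ∀ i, e < i → i ≤ t → A.Central κ i x := by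
    intro i h1 h2
    by_contra h3
    rcases h2.lt_or_eq with h4 | rfl
    · have := hmax i ⟨⟨by omega, h4⟩, h3⟩
      omega
    · exact h3 ht
  exact ⟨e, he.1.2, ⟨he.2, key _ (by omega) (by omega)⟩, key⟩

open Classical in
/-- The elements of the center in the `t`-th permutation. -/
def center (κ : ℕ) (t : ℤ) : Finset (Fin n) := Finset.univ.filter (A.Central κ t)

open Classical in
/-- The elements that never leave the center. -/
def eternal (κ : ℕ) : Finset (Fin n) := Finset.univ.filter fun x => ∀ t, A.Central κ t x

theorem mem_center {κ : ℕ} {t : ℤ} {x : Fin n} : x ∈ A.center κ t ↔ A.Central κ t x := by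
  simp [center]

theorem mem_eternal {κ : ℕ} {x : Fin n} : x ∈ A.eternal κ ↔ ∀ t, A.Central κ t x := by
  simp [eternal]

theorem eternal_subset (κ : ℕ) (t : ℤ) : A.eternal κ ⊆ A.center κ t := fun _ hx =>
  A.mem_center.2 (A.mem_eternal.1 hx t)

theorem card_center (κ : ℕ) (t : ℤ) : (A.center κ t).card = n - 2 * κ := by
  have h : (A.center κ t).image (A.pos t) = Finset.Ico κ (n - κ) := by
    ext i
    simp only [Finset.mem_image, mem_center, Finset.mem_Ico, Central]
    constructor
    · rintro ⟨x, hx, rfl⟩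
      omega
    · intro hi
      refine ⟨A.perm t ⟨i, by omega⟩, ?_⟩
      have h : A.pos t (A.perm t ⟨i, by omega⟩) = i := by simp [pos]
      exact ⟨by omega, h⟩
  rw [← Finset.card_image_of_injective _ (A.pos_injective t), h, Nat.card_Ico]
  omega

theorem pos_succ_le (t : ℤ) (x : Fin n) : A.pos (t + 1) x ≤ A.pos t x + 1 := by
  by_cases h : x = A.hi t
  · subst h
    rw [A.pos_succ_hi, A.pos_lo]
  · by_cases h' : x = A.lo t
    · subst h'
      rw [A.pos_succ_lo, A.pos_lo]
      omega
    · rw [A.pos_succ_of_ne h h']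
      omega

/-- Otherwise the center would be constant. The element at the front at time 0 would then never
enter it, and moving one position at a time it could not get across to become last. -/
theorem card_eternal_lt {κ : ℕ} (hκ : 1 ≤ κ) (hn : 2 * κ < n) :
    (A.eternal κ).card < n - 2 * κ := by
  by_contra hle
  have heq : ∀ t, A.eternal κ = A.center κ t := fun t =>
    Finset.eq_of_subset_of_card_le (A.eternal_subset κ t) (by rw [card_center]; omega)
  have hx0 : A.pos 0 (A.perm 0 ⟨0, by omega⟩) = 0 := by simp [pos]
  generalize A.perm 0 ⟨0, by omega⟩ = x at hx0
  have hx : ∀ t, ¬ A.Central κ t x := by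
    intro t h
    rw [← A.mem_center, ← heq t, heq 0, mem_center, Central] at h
    omega
  have key : ∀ t, 0 ≤ t → A.pos t x < κ := by
    intro t ht
    induction t, ht using Int.leInduction with
    | base => omega
    | succ t ht ih =>
      have := A.pos_succ_le t x
      have := hx (t + 1)
      rw [Central] at this
      omega
  have h1 := key (0 + A.half) (by have := A.half_nonneg; omega)
  have h2 := A.pos_add_half 0 x
  omega

theorem card_swapped_eq_le_one {p q : Fin n} {s : ℤ} {F : Finset ℤ}
    (hF : ∀ t ∈ F, (s ≤ t ∧ t < s + A.half) ∧ A.swapped t = s(p, q)) : F.card ≤ 1 := by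
  rw [Finset.card_le_one]
  intro t ht t' ht'
  obtain ⟨⟨h1, h2⟩, h3⟩ := hF t ht
  obtain ⟨⟨h1', h2'⟩, h3'⟩ := hF t' ht'
  exact A.swapped_inj h1 h2 h1' h2' (h3.trans h3'.symm)

open Classical in
theorem card_swapped_eq_mem_le {p : Fin n} {D : Finset (Fin n)} {s : ℤ} {F : Finset ℤ}
    (hF : ∀ t ∈ F, (s ≤ t ∧ t < s + A.half) ∧ ∃ q ∈ D, A.swapped t = s(p, q)) :
    F.card ≤ D.card := by
  have hsub : F ⊆ D.biUnion fun q => F.filter fun t => A.swapped t = s(p, q) := by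
    intro t ht
    obtain ⟨-, q, hq, h⟩ := hF t ht
    exact Finset.mem_biUnion.2 ⟨q, hq, Finset.mem_filter.2 ⟨ht, h⟩⟩
  refine (Finset.card_le_card hsub).trans ((Finset.card_biUnion_le_card_mul _ _ 1 ?_).trans_eq
    (mul_one _))
  intro q _
  apply A.card_swapped_eq_le_one (s := s) (p := p) (q := q)
  intro t ht
  rw [Finset.mem_filter] at ht
  exact ⟨(hF t ht.1).1, ht.2⟩

theorem countIco_inner_eternal_le (κ : ℕ) :
    countIco (fun t => A.hi t ∈ A.eternal κ ∨ A.lo t ∈ A.eternal κ) 0 (0 + A.half)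
      ≤ (A.eternal κ).card * (n - 1) := by
  classical
  obtain ⟨F, hF, hc⟩ := exists_finset_card_eq_countIco
    (fun t => A.hi t ∈ A.eternal κ ∨ A.lo t ∈ A.eternal κ) 0 (0 + A.half)
  rw [← hc]
  have hsub : F ⊆ (A.eternal κ).biUnion fun p =>
        (Finset.Ico 0 (0 + A.half)).filter fun t => ∃ q ∈ Finset.univ.erase p,
          A.swapped t = s(p, q) := by
    intro t ht
    have hne := A.hi_ne_lo t
    rw [hF, ← Finset.mem_Ico] at ht
    rw [Finset.mem_biUnion]
    rcases ht.2 with h | h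
    · exact ⟨_, h, Finset.mem_filter.2 ⟨ht.1, A.lo t, by simp [hne.symm], rfl⟩⟩
    · exact ⟨_, h, Finset.mem_filter.2 ⟨ht.1, A.hi t, by simp [hne], Sym2.eq_swap⟩⟩
  refine (Finset.card_le_card hsub).trans (Finset.card_biUnion_le_card_mul _ _ _ ?_)
  intro p _
  refine (A.card_swapped_eq_mem_le (s := 0) (p := p) (D := Finset.univ.erase p) ?_).trans ?_
  · intro t ht
    simpa [and_assoc] using ht
  · simp

/-- Both elements entered the center before t and stayed until t. At the later of these entries, the
other element is already present. -/
theorem exists_enters_of_inner {κ : ℕ} {t : ℤ} (ht : A.Inner κ t) (hhi : A.hi t ∉ A.eternal κ)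
    (hlo : A.lo t ∉ A.eternal κ) (hn : 0 < A.half) :
    ∃ e x y, A.Enters κ e x ∧ A.swapped t = s(x, y) ∧ A.Central κ (e + 1) y ∧ y ∉ A.eternal κ ∧
      y ≠ x := by
  have hne := A.hi_ne_lo t
  rw [Inner, gate_univ] at ht
  have hpl := A.pos_lo t
  obtain ⟨u, hu⟩ := not_forall.1 (mt A.mem_eternal.2 hhi)
  obtain ⟨v, hv⟩ := not_forall.1 (mt A.mem_eternal.2 hlo)
  obtain ⟨e, h1, h2, h3⟩ := A.exists_enters hu (t := t) (by rw [Central]; omega) hn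
  obtain ⟨f, h4, h5, h6⟩ := A.exists_enters hv (t := t) (by rw [Central]; omega) hn
  rcases le_or_gt f e with h | h
  · exact ⟨e, _, _, h2, rfl, h6 _ (by omega) (by omega), hlo, hne.symm⟩
  · exact ⟨f, _, _, h5, Sym2.eq_swap, h3 _ (by omega) (by omega), hhi, hne⟩

theorem enters_add_mul_half {κ : ℕ} (m t : ℤ) {x : Fin n} :
    A.Enters κ (t + m * A.half) x ↔ A.Enters κ t x := by
  rw [Enters, Enters, central_add_mul_half,
    show t + m * A.half + 1 = t + 1 + m * A.half by ring, central_add_mul_half]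

/-- An entry at a boundary transposition determines x; its partner is one of the other non-eternal
elements then in the center, and the pair meets only once per halfperiod. -/
theorem countIco_inner_not_eternal_le {κ : ℕ} (hn : 0 < A.half) :
    countIco (fun t => A.Inner κ t ∧ A.hi t ∉ A.eternal κ ∧ A.lo t ∉ A.eternal κ) 0 (0 + A.half)
      ≤ countIco (A.Boundary κ) 0 (0 + A.half) * (n - 2 * κ - (A.eternal κ).card - 1) := by
  classical
  obtain ⟨F, hF, hc⟩ := exists_finset_card_eq_countIco (fun t => A.Inner κ t ∧
    A.hi t ∉ A.eternal κ ∧ A.lo t ∉ A.eternal κ) 0 (0 + A.half)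
  obtain ⟨B, hB, hc'⟩ := exists_finset_card_eq_countIco (A.Boundary κ) 0 (0 + A.half)
  rw [← hc, ← hc']
  have hsub : F ⊆ B.biUnion fun e =>
          (Finset.Ico 0 (0 + A.half)).filter fun t => ∃ x y, A.Enters κ e x ∧
            A.swapped t = s(x, y) ∧ A.Central κ (e + 1) y ∧ y ∉ A.eternal κ ∧ y ≠ x := by
    intro t ht
    rw [hF, ← Finset.mem_Ico] at ht
    obtain ⟨e, x, y, h1, h2, h3, h4⟩ := A.exists_enters_of_inner ht.2.1 ht.2.2.1 ht.2.2.2 hn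
    -- The entry may precede the halfperiod under count; reduction modulo `half` brings it back and
    -- keeps the same x and y.
    have hmod : e % A.half = e + (-(e / A.half)) * A.half := by
      have := Int.emod_add_mul_ediv e A.half
      linarith
    have h1' : A.Enters κ (e % A.half) x := by rwa [hmod, enters_add_mul_half]
    have h3' : A.Central κ (e % A.half + 1) y := by
      rwa [hmod, show e + -(e / A.half) * A.half + 1 = e + 1 + -(e / A.half) * A.half by ring,
        central_add_mul_half]
    rw [Finset.mem_biUnion]
    refine ⟨e % A.half, ?_, Finset.mem_filter.2 ⟨ht.1, x, y, h1', h2, h3', h4⟩⟩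
    rw [hB, zero_add]
    exact ⟨⟨Int.emod_nonneg _ hn.ne', Int.emod_lt_of_pos _ hn⟩, h1'.boundary⟩
  refine (Finset.card_le_card hsub).trans (Finset.card_biUnion_le_card_mul _ _ _ ?_)
  intro e _
  by_cases hx : ∃ x, A.Enters κ e x
  · obtain ⟨x, hx⟩ := hx
    have hxG : x ∉ A.eternal κ := fun h => hx.1 (A.mem_eternal.1 h e)
    have hcard : ((A.center κ (e + 1) \ A.eternal κ).erase x).card
        = n - 2 * κ - (A.eternal κ).card - 1 := by
      rw [Finset.card_erase_of_mem (Finset.mem_sdiff.2 ⟨A.mem_center.2 hx.2, hxG⟩),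
        Finset.card_sdiff_of_subset (A.eternal_subset κ _), card_center]
    rw [← hcard]
    apply A.card_swapped_eq_mem_le (s := 0) (p := x)
    intro t ht
    rw [Finset.mem_filter, Finset.mem_Ico] at ht
    obtain ⟨ht, x', y, h1, h2, h3, h4, h5⟩ := ht
    obtain rfl := hx.unique h1
    refine ⟨ht, y, ?_, h2⟩
    rw [Finset.mem_erase, Finset.mem_sdiff, mem_center]
    exact ⟨h5, h3, h4⟩
  · rw [Finset.card_eq_zero.2]
    · exact Nat.zero_le _
    · rw [Finset.filter_eq_empty_iff]
      rintro t - ⟨x, y, h, -⟩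
      exact hx ⟨x, h⟩

/-- The number of transpositions within the center is bounded in terms of the number of those
across its boundary. -/
theorem countIco_inner_le {κ : ℕ} (hκ : 1 ≤ κ) (hn : 2 * κ < n) :
    countIco (A.Inner κ) 0 (0 + A.half)
      ≤ (n - 2 * κ - 1) * max (countIco (A.Boundary κ) 0 (0 + A.half)) (n - 1) := by
  have hhalf : 0 < A.half := A.half_pos (x := ⟨0, by omega⟩) (y := ⟨1, by omega⟩) (by simp)
  have h1 := A.countIco_inner_eternal_le κ
  have h2 := A.countIco_inner_not_eternal_le (κ := κ) hhalf
  have h3 := A.card_eternal_lt hκ hn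
  have h4 := countIco_le_add (U := A.Inner κ) (a := 0) (b := 0 + A.half)
    (Q := fun t => A.hi t ∈ A.eternal κ ∨ A.lo t ∈ A.eternal κ)
    (R := fun t => A.Inner κ t ∧ A.hi t ∉ A.eternal κ ∧ A.lo t ∉ A.eternal κ)
    (fun t _ _ ht => by tauto)
  -- The factor n - 2κ - 1 splits into the eternal elements, each in at most n - 1 transpositions,
  -- and the c remaining choices of a partner.
  obtain ⟨c, hc⟩ : ∃ c, n - 2 * κ - 1 = (A.eternal κ).card + c :=
    ⟨n - 2 * κ - 1 - (A.eternal κ).card, by omega⟩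
  rw [show n - 2 * κ - (A.eternal κ).card - 1 = c by omega] at h2
  have h5 := Nat.mul_le_mul_left (A.eternal κ).card
    (le_max_right (countIco (A.Boundary κ) 0 (0 + A.half)) (n - 1))
  have h6 := Nat.mul_le_mul_left c
    (le_max_left (countIco (A.Boundary κ) 0 (0 + A.half)) (n - 1))
  rw [hc, add_mul]
  rw [mul_comm] at h2
  omega

end AllowableSequence

/-! ### From the counts to the square-root bound -/

namespace AllowableSequence

variable {n : ℕ} (A : AllowableSequence n)

theorem countIco_outer_le_numLE (k : ℕ) :
    countIco (A.Outer Finset.univ (k + 1)) 0 (0 + A.half) ≤ A.numLE k := by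
  classical
  refine le_trans (Finset.card_le_card ?_) (Finset.card_biUnion_le (s := Finset.range (k + 1))
    (t := fun j => (Finset.Ico 0 (0 + A.half)).filter fun i => A.IsCritical (j + 1) i)) |>.trans ?_
  · intro t ht
    simp only [Finset.mem_filter, Finset.mem_biUnion, Finset.mem_range, isCritical_iff] at ht ⊢
    obtain ⟨ht, hw, hg⟩ := ht
    have h1 := A.gate_lt_card hw
    rw [gate_univ, Finset.card_univ, Fintype.card_fin] at h1 hg
    rcases hg with hg | hg
    · exact ⟨A.pos t (A.hi t), by omega, ht, Or.inl rfl⟩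
    · exact ⟨n - (A.pos t (A.hi t) + 2), by omega, ht, Or.inr (by omega)⟩
  · apply le_of_eq
    rw [numLE]
    apply Finset.sum_congr rfl
    intro j _
    rw [num, numFrom, half]

theorem countIco_true : countIco (fun _ => True) 0 (0 + A.half) = n.choose 2 := by
  simp [countIco, half]

theorem countIco_inner_add_outer (κ : ℕ) : countIco (A.Inner κ) 0 (0 + A.half) +
    countIco (A.Outer Finset.univ κ) 0 (0 + A.half) = n.choose 2 := by
  rw [← A.countIco_true]
  have key : ∀ t, A.Outer Finset.univ κ t ↔ ¬ A.Inner κ t := by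
    intro t
    rw [Outer, Inner, Finset.card_univ, Fintype.card_fin]
    simp only [A.within_univ t, true_and]
    omega
  apply le_antisymm
  · exact countIco_add_le (fun _ _ _ _ => trivial) (fun _ _ _ _ => trivial)
      fun t _ _ h h' => (key t).1 h' h
  · exact countIco_le_add fun t _ _ _ => by
      rw [key]
      exact em _

theorem countIco_boundary_add_inner_le {κ : ℕ} (hκ : 1 ≤ κ) (hn : 2 * κ ≤ n) :
    countIco (A.Boundary κ) 0 (0 + A.half) + countIco (A.Inner κ) 0 (0 + A.half)
      ≤ countIco (A.Inner (κ - 1)) 0 (0 + A.half) := by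
  apply countIco_add_le
  · intro t _ _ h
    rw [Boundary] at h
    rw [Inner]
    omega
  · intro t _ _ h
    rw [Inner] at h ⊢
    omega
  · intro t _ _ h h'
    rw [Boundary] at h
    rw [Inner] at h'
    omega

theorem countIco_inner_eq_zero {κ : ℕ} (hn : n ≤ 2 * κ) :
    countIco (A.Inner κ) 0 (0 + A.half) = 0 := by
  classical
  rw [countIco, Finset.card_eq_zero, Finset.filter_eq_empty_iff]
  intro t _ h
  rw [Inner] at h
  omega

theorem twentyseven_mul_countIco_inner_le {κ : ℕ} (hn : 2 * κ < n) (h3 : 3 ≤ n)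
    {e : ℤ} (he : 9 * (κ : ℤ) = 4 * n + e) (he' : -11 ≤ e) :
    27 * (countIco (A.Inner κ) 0 (0 + A.half) : ℤ) ≤ 5 * n ^ 2 - (36 + 5 * e) * n - e ^ 2 - 9 * e := by
  obtain ⟨h1, h2⟩ := A.countIco_outer_ge (S := Finset.univ) κ (by simpa using hn)
  rw [Finset.card_univ, Fintype.card_fin] at h2
  have hsum := A.countIco_inner_add_outer κ
  have hchoose : 2 * ((n.choose 2 : ℕ) : ℤ) = n * (n - 1) := by
    have := Nat.choose_two_right n
    have h4 : 2 * n.choose 2 = n * (n - 1) := by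
      rw [this]
      exact Nat.mul_div_cancel' (Nat.even_mul_pred_self n).two_dvd
    zify [(by omega : 1 ≤ n)] at h4
    exact h4
  zify at hsum
  generalize (countIco (A.Inner κ) 0 (0 + A.half) : ℤ) = a at *
  generalize (countIco (A.Outer Finset.univ κ) 0 (0 + A.half) : ℤ) = M at *
  have h5 : 9 * (κ * (κ + 1) : ℤ) + (3 * κ - n) * (3 * κ - n + 3) ≤ 6 * M := by
    rcases le_or_gt n (3 * κ) with h | h
    · exact h2 h
    -- Since 9κ ≥ 4n - 11 and n ≥ 3, only these values are left. The quadratic term is then -2, so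
    -- the first bound suffices.
    · have h6 : (3 * κ - n : ℤ) = -1 ∨ (3 * κ - n : ℤ) = -2 := by omega
      rcases h6 with h6 | h6 <;> rw [h6] <;> linarith
  obtain rfl : e = 9 * κ - 4 * n := by linarith
  nlinarith

/-- Here 3√((n - 2κ)/n) = √(1 - 2e/n), which exceeds 1 because e is negative; this is compared with
the quadratic polynomial. The extreme value e = -11 accounts for the coefficient 19. -/
theorem countIco_inner_le_of_eq {κ : ℕ} (hn : 2 * κ < n) (h3 : 3 ≤ n)
    {e : ℤ} (he : 9 * (κ : ℤ) = 4 * n + e) (he1 : -11 ≤ e) (he2 : e ≤ -3) :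
    (countIco (A.Inner κ) 0 (0 + A.half) : ℝ) ≤
      1 / 9 * √(((n : ℝ) - 2 * κ) / n) * (5 * (n : ℝ) ^ 2 + 19 * n - 31) := by
  have h := A.twentyseven_mul_countIco_inner_le hn h3 he he1
  have hR : 27 * (countIco (A.Inner κ) 0 (0 + A.half) : ℝ)
      ≤ 5 * n ^ 2 - (36 + 5 * e) * n - e ^ 2 - 9 * e := by exact_mod_cast h
  have heR : 9 * (κ : ℝ) = 4 * n + e := by exact_mod_cast he
  have h3R : (3 : ℝ) ≤ n := by exact_mod_cast h3
  have he2R : (e : ℝ) ≤ -3 := by exact_mod_cast he2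
  have hn0 : (0 : ℝ) < n := by linarith
  generalize (countIco (A.Inner κ) 0 (0 + A.half) : ℝ) = a at *
  have hw : ∀ c : ℝ, 0 ≤ c → c ^ 2 * n ≤ n - 2 * e → c ≤ 3 * √(((n : ℝ) - 2 * κ) / n) := by
    intro c hc0 hc
    have : c / 3 ≤ √(((n : ℝ) - 2 * κ) / n) := by
      apply Real.le_sqrt_of_sq_le
      rw [le_div_iff₀ hn0]
      linarith
    linarith
  have hF : 0 < 5 * (n : ℝ) ^ 2 + 19 * n - 31 := by nlinarith
  suffices hs : 5 * (n : ℝ) ^ 2 - (36 + 5 * e) * n - e ^ 2 - 9 * e ≤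
      3 * √(((n : ℝ) - 2 * κ) / n) * (5 * (n : ℝ) ^ 2 + 19 * n - 31) by linarith
  by_cases h11 : e = -11
  -- For e = -11 the polynomial is 5n² + 19n - 22, so the bound 1 for the root is too weak; √(1 +
  -- 22/n) ≥ 1 + 5/n is used instead. That 9 divides 4n - 11 excludes n = 3 and n = 4.
  · have hc := hw (1 + 5 / n) (by positivity) (by
      rw [h11]
      have h5 : (5 : ℤ) ≤ n := by omega
      have h5R : (5 : ℝ) ≤ n := by exact_mod_cast h5
      have : (1 + 5 / (n : ℝ)) ^ 2 * n = n + 10 + 25 / n := by field_simp; ring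
      rw [this]
      have : 25 / (n : ℝ) ≤ 5 := by rw [div_le_iff₀ hn0]; linarith
      push_cast
      linarith)
    refine le_trans ?_ (mul_le_mul_of_nonneg_right hc hF.le)
    have : (1 + 5 / (n : ℝ)) * (5 * (n : ℝ) ^ 2 + 19 * n - 31)
        = 5 * (n : ℝ) ^ 2 + 44 * n + 64 - 155 / n := by field_simp; ring
    rw [this, h11]
    have : 155 / (n : ℝ) ≤ 155 / 3 := by gcongr
    push_cast
    nlinarith
  · have hc := hw 1 zero_le_one (by linarith)
    refine le_trans ?_ (mul_le_mul_of_nonneg_right hc hF.le)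
    have key : 5 * (n : ℤ) ^ 2 - (36 + 5 * e) * n - e ^ 2 - 9 * e ≤ 1 * (5 * n ^ 2 + 19 * n - 31) := by
      have h1 : -10 ≤ e := by omega
      -- For e = -10 and e = -9 more than n ≥ 3 is needed; divisibility of 4n + e by 9 supplies it.
      interval_cases e <;> first | linarith | (have : (5 : ℤ) ≤ n := by omega); linarith
    exact_mod_cast key

/-- After squaring, (K - 1)²(K + 2) = K³ - 3K + 2 ≤ K³. This is the step that raises κ by one, where
K = n - 2κ drops by two. -/
theorem mul_sqrt_add_two_le {K n : ℝ} (hK : 1 ≤ K) (hn : 0 < n) :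
    (K - 1) * √((K + 2) / n) ≤ K * √(K / n) := by
  have h1 : 0 ≤ (K - 1) * √((K + 2) / n) := mul_nonneg (by linarith) (Real.sqrt_nonneg _)
  have h2 : 0 ≤ K * √(K / n) := mul_nonneg (by linarith) (Real.sqrt_nonneg _)
  rw [← pow_le_pow_iff_left₀ h1 h2 two_ne_zero, mul_pow, mul_pow, Real.sq_sqrt (by positivity),
    Real.sq_sqrt (by positivity), ← mul_div_assoc, ← mul_div_assoc]
  gcongr ?_ / n
  nlinarith

theorem countIco_inner_le_sqrt (κ : ℕ) (hκ : 1 ≤ κ) (hn : 2 * κ ≤ n) (hm : 4 * n ≤ 9 * κ + 11) :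
    (countIco (A.Inner κ) 0 (0 + A.half) : ℝ) ≤
      1 / 9 * √(((n : ℝ) - 2 * κ) / n) * (5 * (n : ℝ) ^ 2 + 19 * n - 31) := by
  induction κ, hκ using Nat.le_induction with
  | base =>
    rcases hn.lt_or_eq with h | h
    · exact A.countIco_inner_le_of_eq h (by omega) (e := 9 - 4 * n) (by omega) (by omega) (by omega)
    · rw [A.countIco_inner_eq_zero h.ge, ← h]
      norm_num
  | succ κ hκ ih =>
    rcases hn.lt_or_eq with hlt | heq
    -- Within the window the quadratic bound applies directly; beyond it, κ still satisfies the
    -- hypotheses and the induction goes on.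
    · rcases le_or_gt (9 * (κ + 1) + 3) (4 * n) with h | h
      · exact A.countIco_inner_le_of_eq hlt (by omega) (e := 9 * ((κ + 1 : ℕ) : ℤ) - 4 * n)
          (by omega) (by omega) (by omega)
      · have hprev := ih (by omega) (by omega)
        have hle := A.countIco_inner_le (κ := κ + 1) (by omega) hlt
        have hdiff := A.countIco_boundary_add_inner_le (κ := κ + 1) (by omega) hn
        rw [Nat.add_sub_cancel] at hdiff
        obtain ⟨K, hK⟩ : ∃ K, n = 2 * (κ + 1) + (K + 1) := ⟨n - 2 * (κ + 1) - 1, by omega⟩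
        rw [show n - 2 * (κ + 1) - 1 = K by omega] at hle
        have hnR : (n : ℝ) = 2 * (κ + 1) + (K + 1) := by exact_mod_cast hK
        have hn5 : (5 : ℝ) ≤ n := by exact_mod_cast (by omega : 5 ≤ n)
        have hn0 : (0 : ℝ) < n := by linarith
        have e1 : ((n : ℝ) - 2 * κ) / n = ((K : ℝ) + 1 + 2) / n := by
          rw [hnR]; ring
        have e2 : ((n : ℝ) - 2 * (κ + 1 : ℕ)) / n = ((K : ℝ) + 1) / n := by
          push_cast; rw [hnR]; ring
        rw [e1] at hprev
        rw [e2]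
        have hK0 : (0 : ℝ) ≤ K := Nat.cast_nonneg K
        have hF : 0 < 5 * (n : ℝ) ^ 2 + 19 * n - 31 := by nlinarith
        have hv0 := Real.sqrt_nonneg (((K : ℝ) + 1) / n)
        -- With many boundary transpositions B, the bounds I(κ + 1) ≤ K B and B + I(κ + 1) ≤ I(κ)
        -- combine to (K + 1) I(κ + 1) ≤ K I(κ). With few, I(κ + 1) ≤ K(n - 1) is bounded directly.
        rcases le_total (n - 1) (countIco (A.Boundary (κ + 1)) 0 (0 + A.half)) with hN | hN
        · rw [max_eq_left hN] at hle
          have h1 := mul_sqrt_add_two_le (K := (K : ℝ) + 1) (n := n) (by linarith) hn0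
          have hle' : (countIco (A.Inner (κ + 1)) 0 (0 + A.half) : ℝ)
              ≤ K * countIco (A.Boundary (κ + 1)) 0 (0 + A.half) := by exact_mod_cast hle
          have hdiff' : (countIco (A.Boundary (κ + 1)) 0 (0 + A.half) : ℝ) +
              countIco (A.Inner (κ + 1)) 0 (0 + A.half)
              ≤ countIco (A.Inner κ) 0 (0 + A.half) := by exact_mod_cast hdiff
          have h2 : ((K : ℝ) + 1) * countIco (A.Inner (κ + 1)) 0 (0 + A.half) ≤
              K * countIco (A.Inner κ) 0 (0 + A.half) := by nlinarith
          have h3 := mul_le_mul_of_nonneg_left hprev hK0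
          have h4 := mul_le_mul_of_nonneg_right h1 hF.le
          rw [← mul_le_mul_iff_right₀ (by linarith : (0 : ℝ) < K + 1)]
          linarith
        · rw [max_eq_right hN] at hle
          have hle' : (countIco (A.Inner (κ + 1)) 0 (0 + A.half) : ℝ) ≤ K * (n - 1) := by
            have := (Nat.cast_le (α := ℝ)).2 hle
            rwa [Nat.cast_mul, Nat.cast_sub (by omega), Nat.cast_one] at this
          have h9 : 9 * ((K : ℝ) + 1) ≤ n + 4 := by exact_mod_cast (by omega : 9 * (K + 1) ≤ n + 4)
          have hsq := Real.sq_sqrt (show (0 : ℝ) ≤ ((K : ℝ) + 1) / n by positivity)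
          set v := √(((K : ℝ) + 1) / n) with hv
          have hsq' : v ^ 2 * n = K + 1 := by rw [hsq]; field_simp
          -- Indeed (3vn)² = 9(K + 1)n ≤ n(n + 4) ≤ (n + 2)². Multiplied by v this gives 3(K + 1) =
          -- 3v²n ≤ v(n + 2).
          have hvn : 3 * (v * n) ≤ n + 2 := by
            refine le_of_sq_le_sq ?_ (by linarith)
            have h13 : (3 * (v * n)) ^ 2 = n * (9 * (K + 1)) := by rw [← hsq']; ring
            rw [h13]
            have h14 := mul_le_mul_of_nonneg_left h9 hn0.le
            linarith
          have hKv : 3 * ((K : ℝ) + 1) ≤ v * (n + 2) := by nlinarith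
          have h10 : 3 * ((n : ℝ) + 2) * (n - 1) ≤ 5 * (n : ℝ) ^ 2 + 19 * n - 31 := by nlinarith
          have h11 := mul_le_mul_of_nonneg_left h10 hv0
          have h12 := mul_le_mul_of_nonneg_right hKv (by linarith : (0 : ℝ) ≤ n - 1)
          nlinarith
    · rw [A.countIco_inner_eq_zero heq.ge, ← heq]
      norm_num

theorem numLE_ge {k : ℕ} (hm : ⌈(4 * (n : ℝ) - 11) / 9⌉ - 1 ≤ (k : ℤ)) (hk : 2 * (k + 1) ≤ n) :
    (A.numLE k : ℝ) ≥ (n.choose 2 : ℝ)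
        - 1 / 9 * √(1 - (2 * (k : ℝ) + 2) / (n : ℝ)) * (5 * (n : ℝ) ^ 2 + 19 * (n : ℝ) - 31) := by
  have h1 := A.countIco_outer_le_numLE k
  have h2 := A.countIco_inner_add_outer (k + 1)
  have hm' : (4 * (n : ℝ) - 11) / 9 ≤ (k + 1 : ℤ) := Int.ceil_le.1 (by omega)
  have h3 := A.countIco_inner_le_sqrt (k + 1) (by omega) hk (by
    rw [div_le_iff₀ (by norm_num)] at hm'
    have : 4 * (n : ℤ) - 11 ≤ (k + 1) * 9 := by exact_mod_cast hm'
    omega)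
  have hn : (n : ℝ) ≠ 0 := by
    have : n ≠ 0 := by omega
    exact_mod_cast this
  have h4 : 1 - (2 * (k : ℝ) + 2) / (n : ℝ) = ((n : ℝ) - 2 * (k + 1 : ℕ)) / n := by
    push_cast
    field_simp
  rw [h4]
  have h5 : (countIco (A.Inner (k + 1)) 0 (0 + A.half) : ℝ) +
      countIco (A.Outer Finset.univ (k + 1)) 0 (0 + A.half) = n.choose 2 := by exact_mod_cast h2
  have h6 : (countIco (A.Outer Finset.univ (k + 1)) 0 (0 + A.half) : ℝ) ≤ A.numLE k := by
    exact_mod_cast h1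
  linarith

end AllowableSequence

/-! ### Allowable sequences from schedules of pairs -/

theorem choose_two_pos_of_lt {n : ℕ} {i j : Fin n} (h : i < j) : (0 : ℤ) < (n.choose 2 : ℕ) := by
  have := j.isLt
  exact_mod_cast Nat.choose_pos (by omega)

/-- A schedule for reversing a list of `n` elements: the pair `i < j` is interchanged at time
`time i j`, and the times of any three pairs on three elements occur in lexicographic order or in
the reverse of it. -/
structure Schedule (n : ℕ) where
  time : Fin n → Fin n → ℤ
  nonneg : ∀ i j, i < j → 0 ≤ time i j
  lt_choose : ∀ i j, i < j → time i j < (n.choose 2 : ℕ)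
  injective : ∀ i j i' j', i < j → i' < j' → time i j = time i' j' → i = i' ∧ j = j'
  surjective : ∀ t : ℤ, 0 ≤ t → t < (n.choose 2 : ℕ) → ∃ i j, i < j ∧ time i j = t
  between : ∀ i j l, i < j → j < l →
    (time i j < time i l ∧ time i l < time j l) ∨ (time j l < time i l ∧ time i l < time i j)

namespace Schedule

variable {n : ℕ} (T : Schedule n)

/-- The number of times that the pair `i < j` has been interchanged before time `t`. -/
def flips (t : ℤ) (i j : Fin n) : ℤ := (t - 1 - T.time i j) / (n.choose 2 : ℕ) + 1

/-- The element `x` precedes the element `y` at time `t`. -/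
def Prec (t : ℤ) (x y : Fin n) : Prop :=
  (x < y ∧ Even (T.flips t x y)) ∨ (y < x ∧ ¬ Even (T.flips t y x))

theorem flips_add {i j : Fin n} (h : i < j) (t : ℤ) :
    T.flips (t + (n.choose 2 : ℕ)) i j = T.flips t i j + 1 := by
  have := choose_two_pos_of_lt h
  rw [flips, flips, show t + (n.choose 2 : ℕ) - 1 - T.time i j
    = t - 1 - T.time i j + (n.choose 2 : ℕ) by ring, Int.add_ediv_of_dvd_right (dvd_refl _),
    Int.ediv_self this.ne']

theorem prec_add (t : ℤ) (x y : Fin n) : T.Prec (t + (n.choose 2 : ℕ)) x y ↔ T.Prec t y x := by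
  rw [Prec, Prec, or_comm]
  apply or_congr
  · refine and_congr_right fun h => ?_
    rw [T.flips_add h, Int.even_add_one, not_not]
  · refine and_congr_right fun h => ?_
    rw [T.flips_add h, Int.even_add_one]

/-- All pairs flip with the same period, so a pair that is earlier within the period is ahead by
zero or one. -/
theorem flips_le_flips {i j i' j' : Fin n} (h : i < j) (h' : i' < j')
    (hle : T.time i j ≤ T.time i' j') (t : ℤ) :
    T.flips t i' j' ≤ T.flips t i j ∧ T.flips t i j ≤ T.flips t i' j' + 1 := by
  have hN := choose_two_pos_of_lt h
  have h1 := T.nonneg i j h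
  have h2 := T.lt_choose i' j' h'
  constructor
  · exact add_le_add_left (Int.ediv_le_ediv hN (by omega)) 1
  · have := Int.ediv_le_ediv hN (show t - 1 - T.time i j ≤ t - 1 - T.time i' j' + (n.choose 2 : ℕ)
      by omega)
    rw [Int.add_ediv_of_dvd_right (dvd_refl _), Int.ediv_self hN.ne'] at this
    rw [flips, flips]
    omega

theorem prec_irrefl (t : ℤ) (x : Fin n) : ¬ T.Prec t x x := by simp [Prec]

theorem prec_asymm {t : ℤ} {x y : Fin n} (h : T.Prec t x y) : ¬ T.Prec t y x := by
  rcases h with ⟨h1, h2⟩ | ⟨h1, h2⟩ <;> simp [Prec, h1, h1.not_gt, h2]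

theorem prec_total {t : ℤ} {x y : Fin n} (h : x ≠ y) : T.Prec t x y ∨ T.Prec t y x := by
  rcases lt_or_gt_of_ne h with h | h
  · exact (em (Even (T.flips t x y))).imp (fun h' => Or.inl ⟨h, h'⟩) fun h' => Or.inr ⟨h, h'⟩
  · exact (em' (Even (T.flips t y x))).imp (fun h' => Or.inr ⟨h, h'⟩) fun h' => Or.inl ⟨h, h'⟩

/-- For i < j < l the flip count of i, l lies between those of i, j and j, l, which differ by at
most one. If the outer two have equal parity, all three counts are equal. -/
theorem prec_trans {t : ℤ} {x y z : Fin n} (hxy : T.Prec t x y) (hyz : T.Prec t y z) :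
    T.Prec t x z := by
  have key : ∀ i j l, i < j → j < l → (Even (T.flips t i j) → Even (T.flips t j l) →
      Even (T.flips t i l)) ∧ (¬ Even (T.flips t i j) → ¬ Even (T.flips t j l) →
      ¬ Even (T.flips t i l)) := by
    intro i j l hij hjl
    have hil := hij.trans hjl
    rcases T.between i j l hij hjl with ⟨h1, h2⟩ | ⟨h1, h2⟩
    · have a1 := T.flips_le_flips hij hil h1.le t
      have a2 := T.flips_le_flips hil hjl h2.le t
      have a3 := T.flips_le_flips hij hjl (h1.trans h2).le t
      simp only [Int.even_iff]
      omega
    · have a1 := T.flips_le_flips hil hij h2.le t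
      have a2 := T.flips_le_flips hjl hil h1.le t
      have a3 := T.flips_le_flips hjl hij (h1.trans h2).le t
      simp only [Int.even_iff]
      omega
  rcases hxy with ⟨h1, h2⟩ | ⟨h1, h2⟩ <;> rcases hyz with ⟨h3, h4⟩ | ⟨h3, h4⟩
  · exact Or.inl ⟨h1.trans h3, (key _ _ _ h1 h3).1 h2 h4⟩
  · rcases lt_trichotomy x z with h | rfl | h
    · exact Or.inl ⟨h, by
        by_contra h5
        exact (key _ _ _ h h3).2 h5 h4 h2⟩
    · exact absurd h2 h4
    · exact Or.inr ⟨h, fun h5 => h4 ((key _ _ _ h h1).1 h5 h2)⟩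
  · rcases lt_trichotomy x z with h | rfl | h
    · exact Or.inl ⟨h, by
        by_contra h5
        exact (key _ _ _ h1 h).2 h2 h5 h4⟩
    · exact absurd h4 h2
    · exact Or.inr ⟨h, fun h5 => h2 ((key _ _ _ h3 h).1 h4 h5)⟩
  · exact Or.inr ⟨h3.trans h1, (key _ _ _ h3 h1).2 h4 h2⟩

open Classical in
/-- The position of `x` at time `t`. -/
def pos (t : ℤ) (x : Fin n) : ℕ := (Finset.univ.filter fun y => T.Prec t y x).card

theorem pos_lt_pos {t : ℤ} {x y : Fin n} (h : T.Prec t x y) : T.pos t x < T.pos t y := by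
  apply Finset.card_lt_card
  refine ⟨fun z hz => ?_, fun hsub => ?_⟩
  · simp only [Finset.mem_filter, Finset.mem_univ, true_and] at hz ⊢
    exact T.prec_trans hz h
  · have := hsub (by simpa using h)
    simp [T.prec_irrefl] at this

theorem pos_lt (t : ℤ) (x : Fin n) : T.pos t x < n := by
  classical
  conv_rhs => rw [← Fintype.card_fin n, ← Finset.card_univ]
  apply Finset.card_lt_card
  refine ⟨Finset.filter_subset _ _, fun hsub => ?_⟩
  have := hsub (Finset.mem_univ x)
  simp [T.prec_irrefl] at this

theorem pos_injective (t : ℤ) : Function.Injective (T.pos t) := by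
  intro x y h
  by_contra hne
  rcases T.prec_total (t := t) hne with h' | h' <;> have := T.pos_lt_pos h' <;> omega

/-- The permutation at time `t`. -/
def perm (t : ℤ) : Equiv.Perm (Fin n) :=
  (Equiv.ofBijective (fun x => (⟨T.pos t x, T.pos_lt t x⟩ : Fin n))
    (Finite.injective_iff_bijective.1 fun x y h => T.pos_injective t (by simpa using h))).symm

theorem perm_symm_apply (t : ℤ) (x : Fin n) : ((T.perm t).symm x : ℕ) = T.pos t x := rfl

theorem pos_perm (t : ℤ) (p : Fin n) : T.pos t (T.perm t p) = p := by
  rw [← perm_symm_apply, Equiv.symm_apply_apply]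

theorem perm_eq_iff {t : ℤ} {p x : Fin n} : T.perm t p = x ↔ T.pos t x = p := by
  rw [← perm_symm_apply, ← Equiv.eq_symm_apply, Fin.ext_iff, eq_comm]

theorem pos_add (t : ℤ) (x : Fin n) :
    T.pos (t + (n.choose 2 : ℕ)) x + T.pos t x + 1 = n := by
  classical
  have h : (Finset.univ : Finset (Fin n)) = (Finset.univ.filter fun y => T.Prec t x y) ∪
      ((Finset.univ.filter fun y => T.Prec t y x) ∪ {x}) := by
    ext y
    simp only [Finset.mem_univ, Finset.mem_union, Finset.mem_filter, true_and,
      Finset.mem_singleton, true_iff]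
    by_cases hy : y = x
    · exact Or.inr (Or.inr hy)
    · rcases T.prec_total (t := t) hy with h | h
      · exact Or.inr (Or.inl h)
      · exact Or.inl h
  have h2 := congrArg Finset.card h
  rw [Finset.card_univ, Fintype.card_fin, Finset.card_union_of_disjoint,
    Finset.card_union_of_disjoint, Finset.card_singleton] at h2
  · simp only [pos, prec_add]
    rw [add_assoc]
    exact h2.symm
  · simp [T.prec_irrefl]
  · rw [Finset.disjoint_left]
    intro y hy hy'
    simp only [Finset.mem_filter, Finset.mem_univ, true_and, Finset.mem_union,
      Finset.mem_singleton] at hy hy'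
    rcases hy' with h | rfl
    · exact T.prec_asymm hy h
    · exact T.prec_irrefl _ _ hy

theorem flips_succ_of_ne {t : ℤ} {i j : Fin n} (h : i < j)
    (hne : t % (n.choose 2 : ℕ) ≠ T.time i j) : T.flips (t + 1) i j = T.flips t i j := by
  have hN := choose_two_pos_of_lt h
  have h1 := T.nonneg i j h
  have h2 := T.lt_choose i j h
  rw [flips, flips]
  generalize ((n.choose 2 : ℕ) : ℤ) = N at *
  generalize T.time i j = τ at *
  congr 1
  have h3 := Int.emod_add_mul_ediv t N
  have h4 := Int.emod_nonneg t hN.ne'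
  have h5 := Int.emod_lt_of_pos t hN
  generalize t / N = q at *
  generalize t % N = r at *
  subst h3
  rw [show r + N * q + 1 - 1 - τ = r - τ + q * N by ring,
    show r + N * q - 1 - τ = r - 1 - τ + q * N by ring, Int.add_mul_ediv_right _ _ hN.ne',
    Int.add_mul_ediv_right _ _ hN.ne']
  congr 1
  rcases lt_or_gt_of_ne hne with h | h
  · rw [Int.ediv_eq_neg_one_of_neg_of_le (by omega) (by omega),
      Int.ediv_eq_neg_one_of_neg_of_le (by omega) (by omega)]
  · rw [Int.ediv_eq_zero_of_lt (by omega) (by omega), Int.ediv_eq_zero_of_lt (by omega) (by omega)]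

theorem flips_succ_of_eq {t : ℤ} {i j : Fin n} (h : i < j)
    (heq : t % (n.choose 2 : ℕ) = T.time i j) : T.flips (t + 1) i j = T.flips t i j + 1 := by
  have hN := choose_two_pos_of_lt h
  rw [flips, flips, ← heq]
  generalize ((n.choose 2 : ℕ) : ℤ) = N at *
  have h3 := Int.emod_add_mul_ediv t N
  rw [show t + 1 - 1 - t % N = 0 + t / N * N by linarith,
    show t - 1 - t % N = -1 + t / N * N by linarith, Int.add_mul_ediv_right _ _ hN.ne',
    Int.add_mul_ediv_right _ _ hN.ne',
    show (-1 : ℤ) / N = -1 from Int.ediv_eq_neg_one_of_neg_of_le (by omega) (by omega)]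
  simp

theorem exists_swap (hn : 2 ≤ n) (t : ℤ) : ∃ x y, T.Prec t x y ∧ T.Prec (t + 1) y x ∧
    ∀ a b, s(a, b) ≠ s(x, y) → (T.Prec (t + 1) a b ↔ T.Prec t a b) := by
  have hN : (0 : ℤ) < (n.choose 2 : ℕ) := by exact_mod_cast Nat.choose_pos hn
  obtain ⟨i, j, hij, ht⟩ := T.surjective (t % (n.choose 2 : ℕ)) (Int.emod_nonneg _ hN.ne')
    (Int.emod_lt_of_pos _ hN)
  have hflip := T.flips_succ_of_eq hij ht.symm
  have hother : ∀ a b, s(a, b) ≠ s(i, j) → (T.Prec (t + 1) a b ↔ T.Prec t a b) := by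
    intro a b hab
    rw [Prec, Prec]
    apply or_congr
    · refine and_congr_right fun h => ?_
      rw [T.flips_succ_of_ne h]
      intro h'
      obtain ⟨rfl, rfl⟩ := T.injective i j a b hij h (ht.trans h')
      exact hab rfl
    · refine and_congr_right fun h => ?_
      rw [T.flips_succ_of_ne h]
      intro h'
      obtain ⟨rfl, rfl⟩ := T.injective i j b a hij h (ht.trans h')
      exact hab Sym2.eq_swap
  by_cases he : Even (T.flips t i j)
  · refine ⟨i, j, Or.inl ⟨hij, he⟩, Or.inr ⟨hij, ?_⟩, hother⟩
    rw [hflip, Int.even_add_one, not_not]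
    exact he
  · refine ⟨j, i, Or.inr ⟨hij, he⟩, Or.inl ⟨hij, ?_⟩, fun a b h => hother a b ?_⟩
    · rwa [hflip, Int.even_add_one]
    · rwa [Sym2.eq_swap (a := i)]

/-- Only one pair changes its order at a time, so every other element keeps its position. -/
theorem exists_swapsAt (hn : 2 ≤ n) (t : ℤ) : ∃ g, SwapsAt (T.perm t) (T.perm (t + 1)) g := by
  classical
  obtain ⟨x, y, hxy, hyx, hother⟩ := T.exists_swap hn t
  have hne : x ≠ y := by
    rintro rfl
    exact T.prec_irrefl _ _ hxy
  have hz : ∀ z, z ≠ x → z ≠ y → T.pos (t + 1) z = T.pos t z := by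
    intro z hzx hzy
    rw [pos, pos]
    congr 1
    apply Finset.filter_congr
    intro a _
    apply hother
    rw [Ne, Sym2.eq_iff]
    rintro (⟨-, h⟩ | ⟨-, h⟩)
    exacts [hzy h, hzx h]
  have hx : T.pos (t + 1) x = T.pos t x + 1 := by
    have : (Finset.univ.filter fun a => T.Prec (t + 1) a x)
        = insert y (Finset.univ.filter fun a => T.Prec t a x) := by
      ext a
      simp only [Finset.mem_filter, Finset.mem_univ, true_and, Finset.mem_insert]
      by_cases hay : a = y
      · subst hay
        simp [hyx]
      · rw [hother, or_iff_right hay]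
        rw [Ne, Sym2.eq_iff]
        rintro (⟨-, h⟩ | ⟨h, -⟩)
        exacts [hne h, hay h]
    rw [pos, this, Finset.card_insert_of_notMem, pos]
    simpa using T.prec_asymm hxy
  have hlt := T.pos_lt_pos hxy
  have hlt' := T.pos_lt_pos hyx
  -- Otherwise a third element z sits just behind x and stays there, in the very position that x
  -- moves to.
  have hadj : T.pos t y = T.pos t x + 1 := by
    by_contra h
    have hylt := T.pos_lt t y
    have hpz := T.pos_perm t ⟨T.pos t x + 1, by omega⟩
    generalize T.perm t ⟨T.pos t x + 1, by omega⟩ = z at hpz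
    simp only at hpz
    have hzx : z ≠ x := by rintro rfl; omega
    have hzy : z ≠ y := by rintro rfl; omega
    exact hzx (T.pos_injective (t + 1) (by rw [hz z hzx hzy, hpz, hx]))
  have hy : T.pos (t + 1) y = T.pos t x := by
    have hpz := T.pos_perm t ⟨T.pos (t + 1) y, T.pos_lt _ _⟩
    generalize T.perm t ⟨T.pos (t + 1) y, T.pos_lt _ _⟩ = z at hpz
    simp only at hpz
    by_cases hzx : z = x
    · rw [← hpz, hzx]
    · by_cases hzy : z = y
      · rw [hzy] at hpz
        omega
      · rw [← hz z hzx hzy] at hpz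
        exact absurd (T.pos_injective _ hpz) hzy
  refine ⟨T.pos t y, ⟨T.pos t x, T.pos_lt _ _⟩, ⟨T.pos t y, T.pos_lt _ _⟩, hadj.symm, rfl, ?_⟩
  have ex : T.perm t ⟨T.pos t x, T.pos_lt _ _⟩ = x := T.perm_eq_iff.2 rfl
  have ey : T.perm t ⟨T.pos t y, T.pos_lt _ _⟩ = y := T.perm_eq_iff.2 rfl
  refine Equiv.ext fun r => ?_
  rw [Equiv.Perm.mul_apply]
  by_cases h1 : r = ⟨T.pos t x, T.pos_lt _ _⟩
  · subst h1
    rw [Equiv.swap_apply_left, ey, perm_eq_iff, hy]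
  · by_cases h2 : r = ⟨T.pos t y, T.pos_lt _ _⟩
    · subst h2
      rw [Equiv.swap_apply_right, ex, perm_eq_iff, hx, ← hadj]
    · rw [Equiv.swap_apply_of_ne_of_ne h1 h2, perm_eq_iff, hz, pos_perm]
      · intro h
        apply h1
        rw [← h]
        exact Fin.ext (T.pos_perm t r).symm
      · intro h
        apply h2
        rw [← h]
        exact Fin.ext (T.pos_perm t r).symm

/-- The allowable sequence that follows a schedule. -/
def toAllowableSequence (hn : 2 ≤ n) : AllowableSequence n where
  perm := T.perm
  adjacent := T.exists_swapsAt hn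
  reverse j p := by
    rw [eq_comm, perm_eq_iff]
    have h1 := T.pos_add j (T.perm j p)
    rw [pos_perm] at h1
    rw [Fin.val_rev]
    omega

variable (hn : 2 ≤ n)

theorem pos_toAllowableSequence (t : ℤ) (x : Fin n) :
    (T.toAllowableSequence hn).pos t x = T.pos t x := rfl

theorem even_flips_iff {t : ℤ} (h0 : 0 ≤ t) (ht : t ≤ (n.choose 2 : ℕ)) {i j : Fin n} (h : i < j) :
    Even (T.flips t i j) ↔ t ≤ T.time i j := by
  have h1 := T.nonneg i j h
  have h2 := T.lt_choose i j h
  rw [flips]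
  rcases le_or_gt t (T.time i j) with h3 | h3
  · rw [Int.ediv_eq_neg_one_of_neg_of_le (by omega) (by omega)]
    simp [h3]
  · rw [Int.ediv_eq_zero_of_lt (by omega) (by omega)]
    simp [h3]

theorem hi_lo_time {i j : Fin n} (h : i < j) :
    (T.toAllowableSequence hn).hi (T.time i j) = i ∧
    (T.toAllowableSequence hn).lo (T.time i j) = j := by
  have h1 := T.nonneg i j h
  have h2 := T.lt_choose i j h
  have h3 : (T.toAllowableSequence hn).pos (T.time i j) i
      < (T.toAllowableSequence hn).pos (T.time i j) j :=
    T.pos_lt_pos (Or.inl ⟨h, (T.even_flips_iff h1 h2.le h).2 le_rfl⟩)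
  have h4 : (T.toAllowableSequence hn).pos (T.time i j + 1) j
      < (T.toAllowableSequence hn).pos (T.time i j + 1) i :=
    T.pos_lt_pos (Or.inr ⟨h, by rw [T.even_flips_iff (by omega) (by omega) h]; omega⟩)
  have h5 : s(i, j) = (T.toAllowableSequence hn).swapped (T.time i j) := by
    by_contra h5
    rw [← (T.toAllowableSequence hn).pos_lt_succ_iff h5] at h3
    omega
  rw [AllowableSequence.swapped, Sym2.eq_iff] at h5
  rcases h5 with h5 | h5
  · exact ⟨h5.1.symm, h5.2.symm⟩
  · have := (T.toAllowableSequence hn).pos_hi_lt (T.time i j)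
    rw [← h5.1, ← h5.2] at this
    omega

end Schedule

/-! ### Point sets: slopes, general position and sides of lines -/

theorem card_pairs_lt (n : ℕ) : Fintype.card {p : Fin n × Fin n // p.1 < p.2} = n.choose 2 := by
  let e : {p : Fin n × Fin n // p.1 < p.2} ≃ Σ j : Fin n, Fin j :=
    { toFun := fun p => ⟨p.1.2, ⟨p.1.1, p.2⟩⟩
      invFun := fun q => ⟨(⟨q.2, q.2.isLt.trans q.1.isLt⟩, q.1), q.2.isLt⟩
      left_inv := fun p => rfl
      right_inv := fun q => rfl }
  rw [Fintype.card_congr e, Fintype.card_sigma]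
  simp only [Fintype.card_fin]
  rw [Fin.sum_univ_eq_sum_range (fun i => i), Finset.sum_range_id, Nat.choose_two_right]

/-- The pairs of points with distinct abscissae, in the order of the slopes of their connecting
lines, form a schedule. -/
theorem exists_schedule {n : ℕ} {X Y : Fin n → ℝ} (hX : StrictMono X)
    (hA : ∀ i j l, i < j → j < l → (X j - X i) * (Y l - Y i) - (Y j - Y i) * (X l - X i) ≠ 0) :
    ∃ T : Schedule n, ∀ i j l, i < j → j < l →
      (0 < (X j - X i) * (Y l - Y i) - (Y j - Y i) * (X l - X i) →
        T.time i j < T.time i l ∧ T.time i l < T.time j l) ∧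
      ((X j - X i) * (Y l - Y i) - (Y j - Y i) * (X l - X i) < 0 →
        T.time j l < T.time i l ∧ T.time i l < T.time i j) := by
  classical
  let slope : {p : Fin n × Fin n // p.1 < p.2} → ℝ := fun p =>
    (Y p.1.2 - Y p.1.1) / (X p.1.2 - X p.1.1)
  let e₀ := (Fintype.equivFinOfCardEq (card_pairs_lt n)).symm
  -- Equal slopes are ordered arbitrarily. Pairs that share a point have distinct slopes by `hA`,
  -- and a schedule does not constrain disjoint pairs.
  let e := (Tuple.sort (slope ∘ e₀)).trans e₀
  have hmono : Monotone (slope ∘ e) := Tuple.monotone_sort (slope ∘ e₀)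
  have hlt : ∀ p q, slope p < slope q → e.symm p < e.symm q := by
    intro p q h
    by_contra hle
    have := hmono (not_lt.1 hle)
    simp only [Function.comp_apply, Equiv.apply_symm_apply] at this
    linarith
  let time : Fin n → Fin n → ℤ := fun i j => if h : i < j then ((e.symm ⟨(i, j), h⟩ : ℕ) : ℤ) else 0
  have htime : ∀ i j (h : i < j), time i j = ((e.symm ⟨(i, j), h⟩ : ℕ) : ℤ) := fun i j h => dif_pos h
  have htime_lt : ∀ i j i' j', i < j → i' < j' →
      (Y j - Y i) * (X j' - X i') < (Y j' - Y i') * (X j - X i) → time i j < time i' j' := by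
    intro i j i' j' h h' hs
    rw [htime i j h, htime i' j' h', Nat.cast_lt]
    apply hlt
    simp only [slope]
    rwa [div_lt_div_iff₀ (sub_pos.2 (hX h)) (sub_pos.2 (hX h'))]
  have key : ∀ i j l, i < j → j < l →
      (0 < (X j - X i) * (Y l - Y i) - (Y j - Y i) * (X l - X i) →
        time i j < time i l ∧ time i l < time j l) ∧
      ((X j - X i) * (Y l - Y i) - (Y j - Y i) * (X l - X i) < 0 →
        time j l < time i l ∧ time i l < time i j) := by
    intro i j l hij hjl
    have hil := hij.trans hjl
    exact ⟨fun h => ⟨htime_lt _ _ _ _ hij hil (by linarith), htime_lt _ _ _ _ hil hjl (by linarith)⟩,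
      fun h => ⟨htime_lt _ _ _ _ hjl hil (by linarith), htime_lt _ _ _ _ hil hij (by linarith)⟩⟩
  refine ⟨⟨time, ?_, ?_, ?_, ?_, ?_⟩, key⟩
  · intro i j h
    rw [htime i j h]
    exact Int.natCast_nonneg _
  · intro i j h
    rw [htime i j h, Nat.cast_lt]
    exact Fin.isLt _
  · intro i j i' j' h h' heq
    rw [htime i j h, htime i' j' h', Nat.cast_inj, ← Fin.ext_iff, e.symm.injective.eq_iff,
      Subtype.mk.injEq, Prod.mk.injEq] at heq
    exact heq
  · intro t h0 ht
    obtain ⟨m, rfl⟩ := Int.eq_ofNat_of_zero_le h0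
    refine ⟨(e ⟨m, by omega⟩).1.1, (e ⟨m, by omega⟩).1.2, (e ⟨m, by omega⟩).2, ?_⟩
    rw [htime _ _ (e ⟨m, by omega⟩).2]
    simp
  · intro i j l hij hjl
    rcases lt_or_gt_of_ne (hA i j l hij hjl) with h | h
    · exact Or.inr ((key i j l hij hjl).2 h)
    · exact Or.inl ((key i j l hij hjl).1 h)

theorem collinear_of_signedArea_eq_zero {p q r : EuclideanSpace ℝ (Fin 2)} (hpq : p ≠ q)
    (h : signedArea p q r = 0) : Collinear ℝ {p, q, r} := by
  rw [collinear_iff_of_mem (p₀ := p) (by simp)]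
  refine ⟨q - p, ?_⟩
  rw [signedArea] at h
  simp only [Set.mem_insert_iff, Set.mem_singleton_iff, forall_eq_or_imp, forall_eq]
  refine ⟨⟨0, by simp⟩, ⟨1, by simp⟩, ?_⟩
  by_cases h0 : q 0 - p 0 = 0
  · have h1 : q 1 - p 1 ≠ 0 := by
      intro h1
      apply hpq
      ext i
      fin_cases i
      · exact (sub_eq_zero.1 h0).symm
      · exact (sub_eq_zero.1 h1).symm
    refine ⟨(r 1 - p 1) / (q 1 - p 1), ?_⟩
    rw [h0, zero_mul, zero_sub, neg_eq_zero, mul_eq_zero, or_iff_right h1] at h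
    ext i
    fin_cases i
    · simp [h0]; linarith
    · simp [h1]
  · refine ⟨(r 0 - p 0) / (q 0 - p 0), ?_⟩
    ext i
    fin_cases i
    · simp [h0]
    · simp
      field_simp
      linarith

theorem signedArea_eq_zero_of_collinear {p q r : EuclideanSpace ℝ (Fin 2)}
    (h : Collinear ℝ {p, q, r}) : signedArea p q r = 0 := by
  rw [collinear_iff_of_mem (p₀ := p) (by simp)] at h
  obtain ⟨v, hv⟩ := h
  obtain ⟨a, ha⟩ := hv q (by simp)
  obtain ⟨b, hb⟩ := hv r (by simp)
  rw [ha, hb, signedArea]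
  simp
  ring

/-- Points on a parabola, whose signed areas are Vandermonde products. A witness is needed because
`sInf` of the empty set of naturals is 0. -/
theorem exists_inGeneralPosition (n : ℕ) :
    ∃ P : Finset (EuclideanSpace ℝ (Fin 2)), P.card = n ∧ InGeneralPosition P := by
  classical
  let f : ℕ → EuclideanSpace ℝ (Fin 2) := fun i => !₂[(i : ℝ), (i : ℝ) ^ 2]
  have hf : Function.Injective f := by
    intro i j h
    have := congrFun (congrArg WithLp.ofLp h) 0
    simpa [f] using this
  refine ⟨(Finset.range n).image f, by rw [Finset.card_image_of_injective _ hf, Finset.card_range],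
    ?_⟩
  intro p hp q hq r hr hpq hpr hqr hcol
  obtain ⟨i, -, rfl⟩ := Finset.mem_image.1 hp
  obtain ⟨j, -, rfl⟩ := Finset.mem_image.1 hq
  obtain ⟨k, -, rfl⟩ := Finset.mem_image.1 hr
  have h := signedArea_eq_zero_of_collinear hcol
  have hij : (i : ℝ) ≠ j := fun h => hpq (by rw [Nat.cast_injective h])
  have hik : (i : ℝ) ≠ k := fun h => hpr (by rw [Nat.cast_injective h])
  have hjk : (j : ℝ) ≠ k := fun h => hqr (by rw [Nat.cast_injective h])
  have : signedArea (f i) (f j) (f k) = ((j : ℝ) - i) * (k - i) * (k - j) := by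
    simp [signedArea, f]
    ring
  rw [this, mul_eq_zero, mul_eq_zero, sub_eq_zero, sub_eq_zero, sub_eq_zero] at h
  rcases h with (h | h) | h
  exacts [hij h.symm, hik h.symm, hjk h.symm]

/-- The points of a finite set can be numbered from left to right, for a suitable direction. -/
theorem exists_enumeration (P : Finset (EuclideanSpace ℝ (Fin 2))) :
    ∃ (c : ℝ) (w : Fin P.card ≃ P),
      StrictMono fun i => (w i : EuclideanSpace ℝ (Fin 2)) 0 + c * (w i).1 1 := by
  classical
  -- The shear must separate the abscissae, so c avoids the finitely many values at which two points
  -- of different ordinate collide.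
  obtain ⟨c, hc⟩ := Infinite.exists_notMem_finset
    ((P ×ˢ P).image fun e => (e.2 0 - e.1 0) / (e.1 1 - e.2 1))
  have hinj : ∀ p ∈ P, ∀ q ∈ P, p 0 + c * p 1 = q 0 + c * q 1 → p = q := by
    intro p hp q hq h
    by_contra hne
    by_cases h1 : p 1 - q 1 = 0
    · apply hne
      have h1' := sub_eq_zero.1 h1
      ext i
      fin_cases i
      · rw [h1'] at h
        exact add_right_cancel h
      · exact h1'
    · apply hc
      rw [Finset.mem_image]
      refine ⟨(p, q), Finset.mem_product.2 ⟨hp, hq⟩, ?_⟩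
      rw [div_eq_iff h1]
      linarith
  let e₀ : Fin P.card ≃ P := P.equivFin.symm
  let f : Fin P.card → ℝ := fun i => (e₀ i).1 0 + c * (e₀ i).1 1
  refine ⟨c, (Tuple.sort f).trans e₀, ?_⟩
  have hmono : Monotone (f ∘ Tuple.sort f) := Tuple.monotone_sort f
  refine hmono.strictMono_of_injective ?_
  intro i j h
  have := hinj _ (e₀ (Tuple.sort f i)).2 _ (e₀ (Tuple.sort f j)).2 h
  exact (Tuple.sort f).injective (e₀.injective (Subtype.ext this))

theorem signedArea_shear (c : ℝ) (p q r : EuclideanSpace ℝ (Fin 2)) :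
    signedArea p q r = ((q 0 + c * q 1) - (p 0 + c * p 1)) * (r 1 - p 1)
      - (q 1 - p 1) * ((r 0 + c * r 1) - (p 0 + c * p 1)) := by
  rw [signedArea]
  ring

theorem signedArea_swap (p q r : EuclideanSpace ℝ (Fin 2)) :
    signedArea q p r = -signedArea p q r := by
  rw [signedArea, signedArea]
  ring

theorem signedArea_rotate (p q r : EuclideanSpace ℝ (Fin 2)) :
    signedArea q r p = signedArea p q r := by
  rw [signedArea, signedArea]
  ring

theorem InGeneralPosition.signedArea_ne_zero {P : Finset (EuclideanSpace ℝ (Fin 2))}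
    (hP : InGeneralPosition P) {p q r : EuclideanSpace ℝ (Fin 2)} (hp : p ∈ P) (hq : q ∈ P)
    (hr : r ∈ P) (hpq : p ≠ q) (hpr : p ≠ r) (hqr : q ≠ r) : signedArea p q r ≠ 0 := fun h =>
  hP p hp q hq r hr hpq hpr hqr (collinear_of_signedArea_eq_zero hpq h)

theorem InGeneralPosition.mem_of_mem_line {P : Finset (EuclideanSpace ℝ (Fin 2))}
    (hP : InGeneralPosition P) {p q r : EuclideanSpace ℝ (Fin 2)} (hp : p ∈ P) (hq : q ∈ P)
    (hr : r ∈ P) (hpq : p ≠ q) (h : r ∈ line[ℝ, p, q]) : r = p ∨ r = q := by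
  by_contra! hne
  exact hP r hr p hp q hq hne.1 hne.2 hpq (collinear_insert_of_mem_affineSpan_pair h)

theorem InGeneralPosition.pair_eq_of_line_eq {P : Finset (EuclideanSpace ℝ (Fin 2))}
    (hP : InGeneralPosition P) {p q p' q' : EuclideanSpace ℝ (Fin 2)} (hp : p ∈ P) (hq : q ∈ P)
    (hp' : p' ∈ P) (hq' : q' ∈ P) (hpq : p ≠ q) (hpq' : p' ≠ q')
    (h : line[ℝ, p, q] = line[ℝ, p', q']) : s(p, q) = s(p', q') := by
  have h1 := hP.mem_of_mem_line hp hq hp' hpq (h ▸ left_mem_affineSpan_pair ℝ p' q')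
  have h2 := hP.mem_of_mem_line hp hq hq' hpq (h ▸ right_mem_affineSpan_pair ℝ p' q')
  rw [Sym2.eq_iff]
  rcases h1 with rfl | rfl <;> rcases h2 with rfl | rfl
  · exact absurd rfl hpq'
  · exact Or.inl ⟨rfl, rfl⟩
  · exact Or.inr ⟨rfl, rfl⟩
  · exact absurd rfl hpq'

open Classical in
theorem leftCount_eq_card {P : Finset (EuclideanSpace ℝ (Fin 2))} {n : ℕ} (w : Fin n ≃ P)
    (p q : EuclideanSpace ℝ (Fin 2)) :
    leftCount P p q = (Finset.univ.filter fun z => 0 < signedArea p q (w z)).card := by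
  rw [leftCount]
  symm
  apply Finset.card_bij (fun z _ => (w z : EuclideanSpace ℝ (Fin 2)))
  · intro z hz
    rw [Finset.mem_filter] at hz ⊢
    exact ⟨(w z).2, hz.2⟩
  · intro a _ b _ h
    exact w.injective (Subtype.ext h)
  · intro r hr
    rw [Finset.mem_filter] at hr
    exact ⟨w.symm ⟨r, hr.1⟩, by simpa using hr.2, by simp⟩

theorem leftCount_add_leftCount {P : Finset (EuclideanSpace ℝ (Fin 2))}
    (hP : InGeneralPosition P) {p q : EuclideanSpace ℝ (Fin 2)} (hp : p ∈ P) (hq : q ∈ P)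
    (hpq : p ≠ q) : leftCount P p q + leftCount P q p + 2 = P.card := by
  classical
  have h : P = (P.filter fun r => 0 < signedArea p q r) ∪
      ((P.filter fun r => 0 < signedArea q p r) ∪ {p, q}) := by
    ext r
    simp only [Finset.mem_union, Finset.mem_filter, Finset.mem_insert, Finset.mem_singleton]
    constructor
    · intro hr
      by_cases hrp : p = r
      · exact Or.inr (Or.inr (Or.inl hrp.symm))
      · by_cases hrq : q = r
        · exact Or.inr (Or.inr (Or.inr hrq.symm))
        · rcases lt_or_gt_of_ne (hP.signedArea_ne_zero hp hq hr hpq hrp hrq) with h | h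
          · exact Or.inr (Or.inl ⟨hr, by rw [signedArea_swap]; linarith⟩)
          · exact Or.inl ⟨hr, h⟩
    · rintro (h | h | rfl | rfl)
      exacts [h.1, h.1, hp, hq]
  have hzero : ∀ a b : EuclideanSpace ℝ (Fin 2), signedArea a b a = 0 ∧ signedArea a b b = 0 := by
    intro a b
    simp only [signedArea]
    constructor <;> ring
  conv_rhs => rw [h]
  rw [Finset.card_union_of_disjoint, Finset.card_union_of_disjoint, Finset.card_pair hpq,
    leftCount, leftCount, add_assoc]
  · rw [Finset.disjoint_left]
    intro r hr hr'
    rw [Finset.mem_filter] at hr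
    rw [Finset.mem_insert, Finset.mem_singleton] at hr'
    rcases hr' with rfl | rfl
    · exact absurd hr.2 (by simp [(hzero q r).2])
    · exact absurd hr.2 (by simp [(hzero r p).1])
  · rw [Finset.disjoint_left]
    intro r hr hr'
    rw [Finset.mem_filter] at hr
    rw [Finset.mem_union, Finset.mem_filter, Finset.mem_insert, Finset.mem_singleton] at hr'
    rcases hr' with h' | rfl | rfl
    · rw [signedArea_swap] at h'
      linarith [h'.2, hr.2]
    · exact absurd hr.2 (by simp [(hzero r q).1])
    · exact absurd hr.2 (by simp [(hzero p r).2])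

/-- Every point set in general position has an allowable sequence that has no more critical
transpositions than the point set has edges. -/
theorem exists_allowableSequence {P : Finset (EuclideanSpace ℝ (Fin 2))}
    (hP : InGeneralPosition P) (h2 : 2 ≤ P.card) :
    ∃ A : AllowableSequence P.card, ∀ k, A.num k ≤ (kEdges P k).card := by
  classical
  obtain ⟨c, w, hw⟩ := exists_enumeration P
  have hne : ∀ {i j}, i ≠ j → (w i : EuclideanSpace ℝ (Fin 2)) ≠ w j := fun hij h =>
    hij (w.injective (Subtype.ext h))
  have hgp : ∀ {i j l}, i ≠ j → i ≠ l → j ≠ l →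
      signedArea (w i) (w j) (w l) ≠ 0 := fun h1 h2 h3 =>
    hP.signedArea_ne_zero (w _).2 (w _).2 (w _).2 (hne h1) (hne h2) (hne h3)
  obtain ⟨T, hT⟩ := exists_schedule (Y := fun i => (w i).1 1) hw (fun i j l hij hjl => by
    rw [← signedArea_shear]
    exact hgp hij.ne (hij.trans hjl).ne hjl.ne)
  simp only [← signedArea_shear] at hT
  have hprec : ∀ {i j}, i < j → ∀ z, T.Prec (T.time i j) z i ↔
      0 < signedArea (w j) (w i) (w z) := by
    intro i j hij z
    have h0 := T.nonneg i j hij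
    have hlt := (T.lt_choose i j hij).le
    rw [Schedule.Prec]
    rcases lt_trichotomy z i with hz | rfl | hz
    · rw [T.even_flips_iff h0 hlt hz, signedArea_swap, signedArea_rotate]
      obtain ⟨ha, hb⟩ := hT z i j hz hij
      rcases lt_or_gt_of_ne (hgp hz.ne (hz.trans hij).ne hij.ne) with h | h
      · have := hb h
        simp only [hz, hz.not_gt, true_and, false_and, or_false]
        exact ⟨fun _ => by linarith, fun _ => by omega⟩
      · have := ha h
        simp only [hz, hz.not_gt, true_and, false_and, or_false]
        exact ⟨fun _ => by omega, fun _ => by linarith⟩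
    · simp [signedArea]
      nlinarith
    · rw [T.even_flips_iff h0 hlt hz]
      simp only [hz, hz.not_gt, true_and, false_and, false_or, not_le]
      rcases lt_trichotomy z j with hzj | rfl | hzj
      · rw [signedArea_rotate (w j) (w i) (w z) |>.symm]
        obtain ⟨ha, hb⟩ := hT i z j hz hzj
        rcases lt_or_gt_of_ne (hgp hz.ne hij.ne hzj.ne) with h | h
        · have := hb h
          exact ⟨fun _ => by omega, fun _ => by linarith⟩
        · have := ha h
          exact ⟨fun _ => h, fun _ => by omega⟩
      · simp [signedArea]
      · rw [signedArea_swap]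
        obtain ⟨ha, hb⟩ := hT i j z hij hzj
        rcases lt_or_gt_of_ne (hgp hij.ne hz.ne hzj.ne) with h | h
        · have := hb h
          exact ⟨fun _ => by linarith, fun _ => by omega⟩
        · have := ha h
          exact ⟨fun _ => by omega, fun _ => by linarith⟩
  refine ⟨T.toAllowableSequence h2, fun k => ?_⟩
  rw [AllowableSequence.num, AllowableSequence.numFrom]
  -- Each transposition is sent to the line through its two points. The line determines the pair in
  -- general position, and the pair determines the time within a halfperiod.
  refine Finset.card_le_card_of_injOn (fun t => line[ℝ,
    (w ((T.toAllowableSequence h2).hi t) : EuclideanSpace ℝ (Fin 2)),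
    (w ((T.toAllowableSequence h2).lo t) : EuclideanSpace ℝ (Fin 2))]) ?_ ?_
  · intro t ht
    simp only [Finset.coe_filter, Finset.mem_Ico, Set.mem_ofPred_eq, zero_add] at ht
    obtain ⟨i, j, hij, rfl⟩ := T.surjective t ht.1.1 ht.1.2
    have hcrit := (AllowableSequence.isCritical_iff _ _ _).1 ht.2
    obtain ⟨h3, h4⟩ := T.hi_lo_time h2 hij
    rw [h3, T.pos_toAllowableSequence] at hcrit
    have hpos : T.pos (T.time i j) i = leftCount P (w j) (w i) := by
      rw [leftCount_eq_card w, Schedule.pos]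
      congr 1
      apply Finset.filter_congr
      exact fun z _ => hprec hij z
    have hsum := leftCount_add_leftCount hP (w i).2 (w j).2 (hne hij.ne)
    simp only [h3, h4]
    rw [Finset.mem_coe, kEdges, Finset.mem_image]
    rcases hcrit with hcrit | hcrit
    · refine ⟨(w j, w i), Finset.mem_filter.2 ⟨Finset.mem_offDiag.2 ⟨(w j).2, (w i).2, hne hij.ne'⟩,
        ?_⟩, ?_⟩
      · simp only
        omega
      · simp only
        rw [Set.pair_comm]
    · refine ⟨(w i, w j), Finset.mem_filter.2 ⟨Finset.mem_offDiag.2 ⟨(w i).2, (w j).2, hne hij.ne⟩,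
        ?_⟩, rfl⟩
      simp only
      omega
  · intro t ht t' ht' heq
    simp only [Finset.coe_filter, Finset.mem_Ico, Set.mem_ofPred_eq] at ht ht'
    have hpair := hP.pair_eq_of_line_eq (w _).2 (w _).2 (w _).2 (w _).2
      (hne ((T.toAllowableSequence h2).hi_ne_lo t))
      (hne ((T.toAllowableSequence h2).hi_ne_lo t')) heq
    have hinj : Function.Injective fun i => (w i : EuclideanSpace ℝ (Fin 2)) := fun i j h =>
      w.injective (Subtype.ext h)
    have hsw : (T.toAllowableSequence h2).swapped t = (T.toAllowableSequence h2).swapped t' := by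
      apply Sym2.map.injective hinj
      simpa only [AllowableSequence.swapped, Sym2.map_mk] using hpair
    exact (T.toAllowableSequence h2).swapped_inj ht.1.1 ht.1.2 ht'.1.1 ht'.1.2 hsw

end KEdges

end

/-! ### The two minima -/

theorem mainTheorem5 (n k : ℕ)
    (hm : ⌈(4 * (n : ℝ) - 11) / 9⌉ - 1 ≤ (k : ℤ))
    (hk : (k : ℝ) ≤ ((n : ℝ) - 2) / 2) :
    (KEdges.minLE n k : ℝ) ≥ (n.choose 2 : ℝ)
        - 1 / 9 * √(1 - (2 * (k : ℝ) + 2) / (n : ℝ)) * (5 * (n : ℝ) ^ 2 + 19 * (n : ℝ) - 31) ∧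
    (KEdges.minLEAllowable n k : ℝ) ≥ (n.choose 2 : ℝ)
        - 1 / 9 * √(1 - (2 * (k : ℝ) + 2) / (n : ℝ)) * (5 * (n : ℝ) ^ 2 + 19 * (n : ℝ) - 31) := by
  have hkn : 2 * (k + 1) ≤ n := by
    have : 2 * ((k : ℝ) + 1) ≤ n := by linarith
    exact_mod_cast this
  -- This point set and its allowable sequence make both sets of values nonempty, so both infima are
  -- attained.
  obtain ⟨P₀, hcard, hgen⟩ := KEdges.exists_inGeneralPosition n
  constructor
  · obtain ⟨P, rfl, hP, h⟩ := Nat.sInf_mem (s := {e | ∃ P : Finset (EuclideanSpace ℝ (Fin 2)),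
      P.card = n ∧ KEdges.InGeneralPosition P ∧ KEdges.numLE P k = e}) ⟨_, P₀, hcard, hgen, rfl⟩
    rw [KEdges.minLE, ← h]
    obtain ⟨A, hA⟩ := KEdges.exists_allowableSequence hP (by omega)
    refine ge_trans ?_ (A.numLE_ge hm hkn)
    exact_mod_cast Finset.sum_le_sum fun j _ => hA j
  · obtain ⟨A₀, -⟩ := KEdges.exists_allowableSequence hgen (by omega)
    subst hcard
    obtain ⟨A, h⟩ := Nat.sInf_mem (s := {e | ∃ A : KEdges.AllowableSequence P₀.card,
      A.numLE k = e}) ⟨_, A₀, rfl⟩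
    rw [KEdges.minLEAllowable, ← h]
    exact A.numLE_ge hm hkn
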